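/- **Setting.** $n$ asynchronous processes $p_1,\dots,p_n$ communicate over an authenticated, reliable point-to-point network. Let $t$ be an integer with $0\le t<n/3$, and let a fixed set $F$ of at most $t$ processes be faulty (Byzantine). An adversary controls the faulty processes, which may send any messages to anyone at any time, and it chooses the order of all message receptions and process steps, depending on everything that has happened so far (including all local states). The only liveness assumption, required with probability one and only for the claims under 5, is that every message broadcast by a non-faulty process is eventually received by every non-faulty process, and that a non-faulty process whose next step is enabled eventually takes a step. No fairness of the scheduler is assumed beyond this. *Strong $(t+1)$ common coin.* For each round $r$ there is one fair bit $c_r$, the coins of different rounds being independent. A call of $\mathsf{random}()$ in round $r$ returns $c_r$, and $c_r$ is revealed (to processes and to the adversary) exactly when $t+1$ non-faulty processes have called $\mathsf{random}()$ in round $r$. *S-Broadcast.* A call $\text{S-Broadcast}\ \mathrm{EST}[r](v,b)$ with value $v\in\{0,1\}$ and Boolean $b$ broadcasts the message $\mathrm{EST}[r],\mathrm{SVAL}(v)$ if $b$ is true, and returns a pointer to a Boolean that is initially false. From then on, once $\mathrm{EST}[r],\mathrm{SVAL}(v)$ has been received from $t+1$ different processes, the caller broadcasts it if it has not yet done so;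 once it has been received from $2t+1$ different processes, the Boolean is set to true. (Messages received before the call are buffered and count.) *The algorithm.* A non-faulty process $p_i$ with proposal $v_i\in\{0,1\}$ sets $s\leftarrow\neg v_i$, $r\leftarrow 0$, $\mathit{support}\leftarrow\text{false}$, $\mathit{binptr}[s]\leftarrow\text{S-Broadcast}\ \mathrm{EST}[1](s,\text{false})$, and then repeats forever: 1. $r\leftarrow r+1$; $\mathit{binptr}[\neg s]\leftarrow\text{S-Broadcast}\ \mathrm{EST}[r](\neg s,\neg\mathit{support})$; 2. wait until $\mathit{binptr}[0]$ or $\mathit{binptr}[1]$ is true; let $w=s$ if $\mathit{support}$ is true, otherwise $w=0$ if $\mathit{binptr}[0]$ is true, otherwise $w=1$; broadcast $\mathrm{AUX}[r](w)$; 3. wait until there are messages $\mathrm{AUX}[r](\cdot)$ received from $n-t$ distinct processes whose values $v$ all satisfy $\mathit{binptr}[v]=\text{true}$; let $\mathit{view}$ be the set of these values; 4. $s\leftarrow\mathsf{random}()$; if $\mathit{view}=\{s\}$, set $\mathit{support}\leftarrow\text{true}$ and decide $s$ if no decision was taken before; if $\mathit{view}=\{0,1\}$, set $\mathit{support}\leftarrow\text{true}$;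 otherwise set $\mathit{support}\leftarrow\text{false}$. **Theorem.** For every choice of $n$, $t$, $F$, proposals and adversary strategy as above, the algorithm solves binary Byzantine consensus without a fair scheduler: 1. (Agreement) in every execution, no two non-faulty processes decide different values; 2. (Validity) in every execution, if all non-faulty processes propose the same value, no non-faulty process decides another value; 3. in every execution, a non-faulty process that decides in round $r$ decides the coin value $c_r$; 4. in every execution, the number of broadcasts that a non-faulty process performs for round $1$ (messages with round number $1$, echoes included) is at most $3$, and at least $2$ once it has completed the round; for every round $r\ge2$ it is at most $2$, and at least $1$ once the process has completed round $r$; 5. (Termination) with probability one every non-faulty process decides, and the expected number of rounds until all non-faulty processes have decided is $O(1)$: it is at most $6$, independently of $n$, $t$, $F$, the proposals and the adversary. -/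

import Mathlib

open MeasureTheory ProbabilityTheory
open scoped ENNReal

namespace BBC

/-! Binary values are `Bool` (`false` is 0, `true` is 1); the processes are `Fin n`;
`t` is the resilience parameter. -/

/-- Messages: `sval r v` is the message `EST[r], SVAL(v)` of the S-Broadcast instance with
tag `EST[r]` and value `v`; `aux r v` is the message `AUX[r](v)`. -/
inductive Msg where
  | sval (r : ℕ) (v : Bool)
  | aux (r : ℕ) (v : Bool)
  deriving DecidableEq

/-- The round number carried by a message. -/
def Msg.round : Msg → ℕ
  | .sval r _ => r
  | .aux r _ => r

/-- Where the main thread of a process is: `propose` not yet invoked, in the wait for a true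
`binptr`, in the wait for `n - t` AUX messages, or in a pending call of `random()`. -/
inductive PC where
  | idle
  | waitPtr
  | waitAux
  | waitCoin
  deriving DecidableEq

/-- Local state of a process. -/
structure LState (n : ℕ) where
  /-- position of the main thread -/
  pc : PC
  /-- the current round `r_i` -/
  round : ℕ
  /-- the value `s_i` of the most recent coin -/
  s : Bool
  /-- the Boolean `supportcoin_i` -/
  support : Bool
  /-- `binptr_i[v]` points to the Boolean of the S-Broadcast instance `EST[ptr v]` for `v` -/
  ptr : Bool → ℕ
  /-- the S-Broadcast instances (tag `EST[r]`, value `v`) invoked so far -/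
  called : Finset (ℕ × Bool)
  /-- the messages received so far, with their (authenticated) senders -/
  recv : Finset (Fin n × Msg)
  /-- log of all broadcasts performed so far, one entry for each broadcast -/
  sent : List Msg
  /-- the set `view_i[r_i]` computed last -/
  view : Finset Bool
  /-- the decision, if any, with the round in which it was taken -/
  decision : Option (ℕ × Bool)

namespace LState

variable {n : ℕ}

/-- State before `propose` is invoked. -/
def init : LState n where
  pc := .idle
  round := 0
  s := false
  support := false
  ptr := fun _ => 0
  called := ∅
  recv := ∅
  sent := []
  view := ∅
  decision := none

/-- Processes from which the message `m` has been received. -/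
def senders (L : LState n) (m : Msg) : Finset (Fin n) :=
  Finset.univ.filter fun j => (j, m) ∈ L.recv

/-- Log a broadcast of `m`. -/
def bcast (L : LState n) (m : Msg) : LState n := { L with sent := m :: L.sent }

/-! ### S-Broadcast

Messages of an instance that arrive before the instance is invoked are kept in `recv` and are
taken into account at the invocation. -/

/-- The echo rule of the handler of instance `(r, v)`: after `t + 1` receptions from different
processes, broadcast `EST[r], SVAL(v)` if not yet broadcast. -/
def echo (t : ℕ) (L : LState n) (r : ℕ) (v : Bool) : LState n :=
  if (r, v) ∈ L.called ∧ t + 1 ≤ (L.senders (.sval r v)).card ∧ Msg.sval r v ∉ L.sent then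
    L.bcast (.sval r v)
  else L

/-- The Boolean returned by the instance `(r, v)`: it is false at the invocation and is set, for
ever, once `EST[r], SVAL(v)` has been received from `2t + 1` different processes. -/
def svalue (t : ℕ) (L : LState n) (r : ℕ) (v : Bool) : Prop :=
  (r, v) ∈ L.called ∧ 2 * t + 1 ≤ (L.senders (.sval r v)).card

instance (t : ℕ) (L : LState n) (r : ℕ) (v : Bool) : Decidable (L.svalue t r v) :=
  inferInstanceAs (Decidable (_ ∧ _))

/-- The call `binptr[v] ← S-Broadcast EST[r](v, should)`. -/
def sBroadcast (t : ℕ) (L : LState n) (r : ℕ) (v should : Bool) : LState n :=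
  let L₁ : LState n :=
    { L with called := insert (r, v) L.called, ptr := Function.update L.ptr v r }
  let L₂ : LState n := if should then L₁.bcast (.sval r v) else L₁
  L₂.echo t r v

/-- Reception of the message `m` from process `j`. -/
def receive (t : ℕ) (L : LState n) (j : Fin n) (m : Msg) : LState n :=
  let L₁ : LState n := { L with recv := insert (j, m) L.recv }
  match m with
  | .sval r v => L₁.echo t r v
  | .aux _ _ => L₁

/-! ### The consensus algorithm (main thread) -/

/-- `binptr_i[v] = true`. -/
def binptr (t : ℕ) (L : LState n) (v : Bool) : Prop := L.svalue t (L.ptr v) v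

instance (t : ℕ) (L : LState n) (v : Bool) : Decidable (L.binptr t v) :=
  inferInstanceAs (Decidable (L.svalue t (L.ptr v) v))

/-- Start of a round: `r ← r + 1; binptr[¬s] ← S-Broadcast EST[r](¬s, ¬supportcoin)`. -/
def newRound (t : ℕ) (L : LState n) : LState n :=
  let L₁ : LState n := { L with round := L.round + 1, pc := .waitPtr }
  L₁.sBroadcast t L₁.round (!L₁.s) (!L₁.support)

/-- `propose(v)`: `s ← ¬v; r ← 0; supportcoin ← false;
binptr[s] ← S-Broadcast EST[1](s, false)`; then the first round starts. -/
def propose (t : ℕ) (L : LState n) (v : Bool) : LState n :=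
  let L₁ : LState n := { L with s := !v, round := 0, support := false }
  (L₁.sBroadcast t 1 L₁.s false).newRound t

/-- The wait `binptr[0] = true ∨ binptr[1] = true` is over. -/
def ptrReady (t : ℕ) (L : LState n) : Prop := L.binptr t false ∨ L.binptr t true

instance (t : ℕ) (L : LState n) : Decidable (L.ptrReady t) :=
  inferInstanceAs (Decidable (_ ∨ _))

/-- The value `w`: the first matching case of `supportcoin`, `binptr[0]`, `binptr[1]`. -/
def auxValue (t : ℕ) (L : LState n) : Bool :=
  if L.support then L.s else if L.binptr t false then false else true

/-- `broadcast AUX[r](w)`, then wait for AUX messages. -/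
def sendAux (t : ℕ) (L : LState n) : LState n :=
  { L.bcast (.aux L.round (L.auxValue t)) with pc := .waitAux }

/-- `f` selects AUX messages of the current round from exactly `n - t` distinct processes
(`f j = some v`: the message with value `v` received from `j`), all of whose values `v` satisfy
`binptr[v] = true`. -/
def AuxQuorum (t : ℕ) (L : LState n) (f : Fin n → Option Bool) : Prop :=
  (Finset.univ.filter fun j => f j ≠ none).card = n - t ∧
    ∀ j v, f j = some v → (j, Msg.aux L.round v) ∈ L.recv ∧ L.binptr t v

instance (t : ℕ) (L : LState n) (f : Fin n → Option Bool) : Decidable (L.AuxQuorum t f) :=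
  inferInstanceAs (Decidable (_ ∧ _))

/-- `view[r]` becomes the set of values of the selected messages; `random()` is called. -/
def callCoin (L : LState n) (f : Fin n → Option Bool) : LState n :=
  { L with
    view := Finset.univ.filter fun v => ∃ j, f j = some v
    pc := .waitCoin }

/-- `random()` returns `c`; the end of the round; the next round starts. -/
def coinReturn (t : ℕ) (L : LState n) (c : Bool) : LState n :=
  let L₁ : LState n := { L with s := c }
  let L₂ : LState n :=
    if L₁.view = {c} then
      { L₁ with
        support := true
        decision := if L₁.decision = none then some (L₁.round, c) else L₁.decision }
    else if L₁.view = {false, true} then { L₁ with support := true }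
    else { L₁ with support := false }
  L₂.newRound t

end LState

/-- Global configuration. It never contains a coin that is not yet revealed. -/
structure Config (n : ℕ) where
  /-- local states (those of the faulty processes are meaningless) -/
  loc : Fin n → LState n
  /-- non-faulty processes that have called `random()` in a round -/
  asked : ℕ → Finset (Fin n)
  /-- the outputs of the common coin revealed so far -/
  coin : ℕ → Option Bool

/-- Events that the adversary can schedule. -/
inductive Action (n : ℕ) where
  | skip
  | deliver (i j : Fin n) (m : Msg)
  | propose (i : Fin n)
  | sendAux (i : Fin n)
  | callCoin (i : Fin n) (f : Fin n → Option Bool)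
  | coinReturn (i : Fin n)

namespace Config

variable {n : ℕ}

/-- Initial configuration. -/
def init : Config n := ⟨fun _ => LState.init, fun _ => ∅, fun _ => none⟩

/-- Replace the local state of `i`. -/
def setLoc (C : Config n) (i : Fin n) (L : LState n) : Config n :=
  { C with loc := Function.update C.loc i L }

/-- Non-faulty `i` calls `random()` in round `r`: the output `c r` of the coin for round `r` is
revealed to everybody as soon as `t + 1` non-faulty processes have called. -/
def ask (t : ℕ) (c : ℕ → Bool) (C : Config n) (i : Fin n) (r : ℕ) : Config n :=
  { C with
    asked := Function.update C.asked r (insert i (C.asked r))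
    coin := if t + 1 ≤ (insert i (C.asked r)).card then Function.update C.coin r (some (c r))
      else C.coin }

/-- Effect of an event, for the set `F` of faulty processes, proposals `prop` and coin outputs
`c`. An event that is not enabled has no effect. A faulty process may send any message to any
process at any time; a message of a non-faulty process is received only if it has been
broadcast, and once. -/
def step (t : ℕ) (F : Finset (Fin n)) (prop : Fin n → Bool) (c : ℕ → Bool) (C : Config n) :
    Action n → Config n
  | .skip => C
  | .deliver i j m =>
      if i ∈ F ∨ (m ∈ (C.loc i).sent ∧ (i, m) ∉ (C.loc j).recv) then
        C.setLoc j ((C.loc j).receive t i m)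
      else C
  | .propose i =>
      if i ∉ F ∧ (C.loc i).pc = .idle then C.setLoc i ((C.loc i).propose t (prop i)) else C
  | .sendAux i =>
      if i ∉ F ∧ (C.loc i).pc = .waitPtr ∧ (C.loc i).ptrReady t then
        C.setLoc i ((C.loc i).sendAux t)
      else C
  | .callCoin i f =>
      if i ∉ F ∧ (C.loc i).pc = .waitAux ∧ (C.loc i).AuxQuorum t f then
        (C.setLoc i ((C.loc i).callCoin f)).ask t c i (C.loc i).round
      else C
  | .coinReturn i =>
      if i ∉ F ∧ (C.loc i).pc = .waitCoin then
        match C.coin (C.loc i).round with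
        | some b => C.setLoc i ((C.loc i).coinReturn t b)
        | none => C
      else C

/-- The main thread of process `i` can make a step. -/
def Ready (t : ℕ) (C : Config n) (i : Fin n) : Prop :=
  match (C.loc i).pc with
  | .idle => True
  | .waitPtr => (C.loc i).ptrReady t
  | .waitAux => ∃ f, (C.loc i).AuxQuorum t f
  | .waitCoin => C.coin (C.loc i).round ≠ none

end Config

/-- A strategy of the adversary, who controls the faulty processes, the network and the speed of
all processes: the next event as a function of all past configurations (latest first) and the
present one. As configurations contain only revealed coins, it cannot depend on others. -/
abbrev Adversary (n : ℕ) := List (Config n) → Config n → Action n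

section Execution

variable {n : ℕ} (t : ℕ) (F : Finset (Fin n)) (prop : Fin n → Bool) (A : Adversary n)

/-- Past and present of the execution after `k` events, for coin outputs `c`. -/
def run (c : ℕ → Bool) : ℕ → List (Config n) × Config n
  | 0 => ([], Config.init)
  | k + 1 =>
      let h := run c k
      (h.2 :: h.1, Config.step t F prop c h.2 (A h.1 h.2))

/-- Local state of process `i` after `k` events. -/
def localAt (c : ℕ → Bool) (k : ℕ) (i : Fin n) : LState n := (run t F prop A c k).2.loc i

/-- What an asynchronous reliable system guarantees: every message that a non-faulty process
broadcasts is eventually received by every non-faulty process, and a non-faulty process that can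
make a step eventually makes one (each step of the main thread changes `pc`). -/
def Admissible (c : ℕ → Bool) : Prop :=
  (∀ i ∉ F, ∀ j ∉ F, ∀ k, ∀ m ∈ (localAt t F prop A c k i).sent,
      ∃ k', (i, m) ∈ (localAt t F prop A c k' j).recv) ∧
  (∀ i ∉ F, ∀ k, (run t F prop A c k).2.Ready t i →
      ∃ k' ≥ k, (localAt t F prop A c k' i).pc ≠ (localAt t F prop A c k i).pc)

/-- Process `i` decides `v` in round `r`. -/
def Decides (c : ℕ → Bool) (i : Fin n) (r : ℕ) (v : Bool) : Prop :=
  ∃ k, (localAt t F prop A c k i).decision = some (r, v)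

/-- The round in which `i` decides (`∞` if it never decides). -/
noncomputable def decisionRound (c : ℕ → Bool) (i : Fin n) : ℝ≥0∞ :=
  ⨅ (r : ℕ) (v : Bool) (_ : Decides t F prop A c i r v), (r : ℝ≥0∞)

/-- The first round by which all non-faulty processes have decided. -/
noncomputable def lastDecisionRound (c : ℕ → Bool) : ℝ≥0∞ :=
  ⨆ (i : Fin n) (_ : i ∉ F), decisionRound t F prop A c i

/-- Number of broadcasts for round `r` that process `i` has performed in the first `k` events. -/
def broadcasts (c : ℕ → Bool) (k : ℕ) (i : Fin n) (r : ℕ) : ℕ :=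
  (localAt t F prop A c k i).sent.countP fun m => m.round = r

end Execution

/-- The outputs `coin r` of a strong common coin (one output per round, the same for all
processes): independent fair bits. That an output stays secret until `t + 1` non-faulty
processes have asked for it is part of `Config.ask` and `Adversary`. -/
structure IsStrongCoin {Ω : Type*} [MeasurableSpace Ω] (μ : Measure Ω) (coin : ℕ → Ω → Bool) :
    Prop where
  measurable : ∀ r, Measurable (coin r)
  indep : iIndepFun coin μ
  fair : ∀ r b, μ {ω | coin r ω = b} = 1 / 2

end BBC

/-! Agreement and validity rest on a lock. Two quorums of `n - t` AUX messages share a non-faulty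
sender, which sends one AUX per round, so any two views of a round meet (`view_inter`). If one view
of round `r` is `{c r}`, every view contains `c r`, and every non-faulty process enters round `r +
1` with support. None of them then starts a broadcast of `¬c r` in the new instance, and at most `t`
faulty senders cannot trigger an echo (`sval_notMem_sent`). The pointer for `¬c r` therefore stays
false: `c r` is locked. A lock on `v` persists (`Locked.succ`): a coin equal to `v` recreates it,
while a coin equal to `¬v` leaves the pointer for `¬v` on the same dead instance. Under a lock all
views are `{v}` (`Locked.view_eq`), so a decision fixes all later ones; a common proposal is locked
from round 1.

For progress, some instance of every round becomes true everywhere (`exists_eventually_svalue`):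
either a supporting process already has a true pointer, which spreads, or enough non-faulty
processes broadcast the same value. AUX values have true pointers at their senders, hence eventually
everywhere, and all non-faulty processes reach every round (`eventually_le_round`).

For the expected time, the execution up to the call that reveals `c r` depends only on earlier coins
(`run_congr`). If some process has a singleton view `{v}` by then, `v` is independent of `c r` and
is locked with probability 1/2. Otherwise the `t + 1` callers that reveal the coin all have both
values in view, so they send `c r` in AUX of round `r + 1`, and every view of that round contains `c
r` (`mem_view_of_earlyValue_none`). The value `c r` is then locked if the next coin equals it, again
with probability 1/2. Once a value is locked, the first coin showing it makes everybody decide. A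
potential on these stages, starting at 6 and falling on average by at least 1 per undecided round
(`Stage.potential_next_le`), gives the bound. -/

namespace BBC

/-! ### Local transitions of a process. -/

namespace LState

variable {n : ℕ}

@[simp] lemma mem_senders {L : LState n} {m : Msg} {j : Fin n} :
    j ∈ L.senders m ↔ (j, m) ∈ L.recv := by
  simp [senders]

lemma card_senders_mono {L L' : LState n} (h : L.recv ⊆ L'.recv) (m : Msg) :
    (L.senders m).card ≤ (L'.senders m).card :=
  Finset.card_le_card fun j hj => by simpa using h (by simpa using hj)

/-- The new log is described only by its members and the absence of repetitions. This spares later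
arguments the case distinction whether the echo was logged now or earlier; the other `_spec` lemmas
follow the same pattern. -/
lemma echo_spec (t : ℕ) (L : LState n) (r : ℕ) (v : Bool) :
    ∃ X, L.echo t r v = { L with sent := X } ∧
      (∀ m, m ∈ X ↔ m ∈ L.sent ∨
        (m = .sval r v ∧ (r, v) ∈ L.called ∧ t + 1 ≤ (L.senders (.sval r v)).card)) ∧
      (L.sent.Nodup → X.Nodup) := by
  unfold echo
  split_ifs with h
  · refine ⟨.sval r v :: L.sent, rfl, fun m => ?_, fun hn => List.nodup_cons.2 ⟨h.2.2, hn⟩⟩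
    simp only [List.mem_cons]; tauto
  · refine ⟨L.sent, rfl, fun m => ?_, id⟩
    constructor
    · exact Or.inl
    · rintro (hm | ⟨rfl, h1, h2⟩)
      · exact hm
      · by_contra h3; exact h ⟨h1, h2, h3⟩

/-- Unlike an echo, the initial broadcast does not look at the log, so freedom from repetitions
needs the message to be new. -/
lemma sBroadcast_spec (t : ℕ) (L : LState n) (r : ℕ) (v should : Bool) :
    ∃ X, L.sBroadcast t r v should =
        { L with called := insert (r, v) L.called, ptr := Function.update L.ptr v r, sent := X } ∧
      (∀ m, m ∈ X ↔ m ∈ L.sent ∨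
        (m = .sval r v ∧ (should = true ∨ t + 1 ≤ (L.senders (.sval r v)).card))) ∧
      (L.sent.Nodup → Msg.sval r v ∉ L.sent → X.Nodup) := by
  cases should
  · obtain ⟨X, hX, hm, hn⟩ := echo_spec t
      { L with called := insert (r, v) L.called, ptr := Function.update L.ptr v r } r v
    refine ⟨X, ?_, fun m => ?_, fun h _ => hn h⟩
    · simpa [sBroadcast] using hX
    · rw [hm]; simp [senders]
  · obtain ⟨X, hX, hm, hn⟩ := echo_spec t
      { L with called := insert (r, v) L.called, ptr := Function.update L.ptr v r,
               sent := .sval r v :: L.sent } r v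
    refine ⟨X, ?_, fun m => ?_, fun h h' => hn (List.nodup_cons.2 ⟨h', h⟩)⟩
    · simpa [sBroadcast, bcast] using hX
    · rw [hm]; simp [senders]; tauto

lemma receive_spec (t : ℕ) (L : LState n) (j : Fin n) (m : Msg) :
    ∃ X, L.receive t j m = { L with recv := insert (j, m) L.recv, sent := X } ∧
      (∀ m', m' ∈ X ↔ m' ∈ L.sent ∨ ∃ r v, m = .sval r v ∧ m' = .sval r v ∧ (r, v) ∈ L.called ∧
        t + 1 ≤ ((L.receive t j m).senders (.sval r v)).card) ∧
      (L.sent.Nodup → X.Nodup) := by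
  cases m with
  | sval r v =>
    obtain ⟨X, hX, hm, hn⟩ := echo_spec t
      { L with recv := insert (j, .sval r v) L.recv } r v
    have hX' : L.receive t j (.sval r v) =
      { L with recv := insert (j, .sval r v) L.recv, sent := X } := by simpa [receive] using hX
    refine ⟨X, hX', fun m => ?_, hn⟩
    rw [hm, hX']
    simp only [senders, Msg.sval.injEq]
    constructor
    · rintro (h | ⟨h1, h2, h3⟩)
      · exact Or.inl h
      · exact Or.inr ⟨r, v, ⟨rfl, rfl⟩, h1, h2, h3⟩
    · rintro (h | ⟨r, v, ⟨rfl, rfl⟩, h1, h2, h3⟩)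
      · exact Or.inl h
      · exact Or.inr ⟨h1, h2, h3⟩
  | aux r v => exact ⟨L.sent, rfl, by simp, id⟩

lemma newRound_spec (t : ℕ) (L : LState n) :
    ∃ X, L.newRound t =
        { L with round := L.round + 1, pc := .waitPtr,
                 called := insert (L.round + 1, !L.s) L.called,
                 ptr := Function.update L.ptr (!L.s) (L.round + 1), sent := X } ∧
      (∀ m, m ∈ X ↔ m ∈ L.sent ∨ (m = .sval (L.round + 1) (!L.s) ∧
        (L.support = false ∨ t + 1 ≤ (L.senders (.sval (L.round + 1) (!L.s))).card))) ∧
      (L.sent.Nodup → Msg.sval (L.round + 1) (!L.s) ∉ L.sent → X.Nodup) := by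
  obtain ⟨X, hX, hm, hn⟩ := sBroadcast_spec t
    { L with round := L.round + 1, pc := .waitPtr } (L.round + 1) (!L.s) (!L.support)
  refine ⟨X, by simpa [newRound] using hX, fun m => ?_, hn⟩
  rw [hm]; simp [senders]

/-- The local state after a first call of `propose(v)`. -/
lemma propose_spec (t : ℕ) (L : LState n) (v : Bool) :
    ∃ X, L.propose t v =
        { L with s := !v, round := 1, support := false, pc := .waitPtr,
                 called := insert (1, v) (insert (1, !v) L.called),
                 ptr := fun _ => 1, sent := X } ∧
      (∀ m, m ∈ X ↔ m ∈ L.sent ∨ m = .sval 1 v ∨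
        (m = .sval 1 (!v) ∧ t + 1 ≤ (L.senders (.sval 1 (!v))).card)) ∧
      (L.sent.Nodup → (∀ b, Msg.sval 1 b ∉ L.sent) → X.Nodup) := by
  obtain ⟨Y, hY, hYm, hYn⟩ := sBroadcast_spec t
    { L with s := !v, round := 0, support := false } 1 (!v) false
  obtain ⟨X, hX, hXm, hXn⟩ := newRound_spec t
    { L with s := !v, round := 0, support := false, called := insert (1, !v) L.called,
             ptr := Function.update L.ptr (!v) 1, sent := Y }
  refine ⟨X, ?_, fun m => ?_, fun h h' => hXn (hYn h (h' _)) ?_⟩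
  · have : L.propose t v = ({ L with
        s := !v, round := 0, support := false, called := insert (1, !v) L.called,
        ptr := Function.update L.ptr (!v) 1, sent := Y } : LState n).newRound t := by
      rw [propose, ← hY]
    rw [this, hX]
    have hp : Function.update (Function.update L.ptr (!v) 1) v 1 = fun _ => 1 := by
      funext b; by_cases hb : b = v
      · simp [hb]
      · have : b = !v := by cases b <;> cases v <;> simp_all
        subst this; simp [Function.update]
    simp [hp]
  · rw [hXm]; simp only [hYm, Bool.not_not]; simp [senders]; tauto
  · simp only [hYm]; simpa using h' v

lemma binptr_congr {t : ℕ} {L L' : LState n} {v : Bool} (h1 : L.ptr v = L'.ptr v)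
    (h2 : (L.ptr v, v) ∈ L.called → (L.ptr v, v) ∈ L'.called) (h3 : L.recv ⊆ L'.recv)
    (h : L.binptr t v) : L'.binptr t v := by
  unfold binptr svalue at *
  rw [← h1]
  exact ⟨h2 h.1, h.2.trans (card_senders_mono h3 _)⟩

lemma svalue_mono {t : ℕ} {L L' : LState n} {r : ℕ} {v : Bool}
    (h2 : L.called ⊆ L'.called) (h3 : L.recv ⊆ L'.recv)
    (h : L.svalue t r v) : L'.svalue t r v :=
  ⟨h2 h.1, h.2.trans (card_senders_mono h3 _)⟩

/-- A supporting process sends the coin value without testing its pointer; the invariant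
`support_ptr` supplies `hs`. Receivers can count on AUX values because of this. -/
lemma binptr_auxValue {t : ℕ} {L : LState n} (hs : L.support = true → L.binptr t L.s)
    (h : L.ptrReady t) : L.binptr t (L.auxValue t) := by
  unfold auxValue
  split_ifs with h1 h2
  · exact hs h1
  · exact h2
  · exact h.resolve_left h2

/-- The possible local transitions of a non-faulty process with proposal `p`; `ok j m` means that
`m` can be received from `j`, and `coin` holds the revealed coins. -/
inductive Step (t : ℕ) (p : Bool) (ok : Fin n → Msg → Prop) (coin : ℕ → Option Bool)
    (L : LState n) : LState n → Prop
  | refl : Step t p ok coin L L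
  | receive (j m) : ok j m → Step t p ok coin L (L.receive t j m)
  | propose : L.pc = .idle → Step t p ok coin L (L.propose t p)
  | sendAux : L.pc = .waitPtr → L.ptrReady t → Step t p ok coin L (L.sendAux t)
  | callCoin (f) : L.pc = .waitAux → L.AuxQuorum t f → Step t p ok coin L (L.callCoin f)
  | coinReturn (b) : L.pc = .waitCoin → coin L.round = some b →
      Step t p ok coin L (L.coinReturn t b)

/-- The support flag computed at the end of a round from the view and the coin. -/
def nextSupport (X : Finset Bool) (b : Bool) : Bool := decide (X = {b} ∨ X = {false, true})

/-- The state at the end of a round, just before the next round starts. -/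
def endRound (L : LState n) (b : Bool) : LState n :=
  { L with
    s := b
    support := nextSupport L.view b
    decision := if L.view = {b} ∧ L.decision = none then some (L.round, b) else L.decision }

lemma coinReturn_eq (t : ℕ) (L : LState n) (b : Bool) :
    L.coinReturn t b = (L.endRound b).newRound t := by
  unfold coinReturn endRound nextSupport
  by_cases h1 : L.view = {b}
  · by_cases h2 : L.decision = none <;> simp [h1, h2]
  · by_cases h2 : L.view = {false, true}
    · have h3 : ({false, true} : Finset Bool) ≠ {b} := h2 ▸ h1
      simp [h2, h3]
    · simp [h1, h2]

/-- The state is past the wait for a true `binptr` of round `r`. -/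
def PastPtr (L : LState n) (r : ℕ) : Prop :=
  r < L.round ∨ (r = L.round ∧ (L.pc = .waitAux ∨ L.pc = .waitCoin))

end LState

/-! ### Pointers as functions of the coins, and the local invariant. -/

/-- The round of the S-Broadcast instance to which `binptr[v]` points in round `r`. -/
def lastPtr (c : ℕ → Bool) : ℕ → Bool → ℕ
  | 0, _ => 0
  -- A pointer survives a round exactly when the coin shows its value. The guard makes both pointers
  -- equal to 1 in round 1, since `c 0` is not a coin of any round.
  | r + 1, v => if 1 ≤ r ∧ c r = v then lastPtr c r v else r + 1

/-- The S-Broadcast instance `(r, v)` is invoked by every process that reaches round `r`. -/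
def Invoked (c : ℕ → Bool) (r : ℕ) (v : Bool) : Prop := 1 ≤ r ∧ (r = 1 ∨ v = !c (r - 1))

lemma lastPtr_le (c : ℕ → Bool) (r : ℕ) (v : Bool) : lastPtr c r v ≤ r := by
  induction r with
  | zero => simp [lastPtr]
  | succ r ih => rw [lastPtr]; split_ifs <;> omega

/-- A pointer changes only when its value is opposite to the last coin, which is when every process
invokes the new instance. Liveness uses this: nobody waits on an instance that others skip. -/
lemma invoked_lastPtr (c : ℕ → Bool) {r : ℕ} (hr : 1 ≤ r) (v : Bool) :
    Invoked c (lastPtr c r v) v := by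
  induction r with
  | zero => omega
  | succ r ih =>
    rw [lastPtr]; split_ifs with h
    · exact ih h.1
    · refine ⟨by omega, ?_⟩
      by_cases h1 : r = 0
      · simp [h1]
      · right
        have : c r ≠ v := fun h2 => h ⟨by omega, h2⟩
        simpa using (Bool.eq_not_of_ne this.symm)

/-- What holds of the local state of a non-faulty process with proposal `p`, for coin outputs
`c`. -/
structure LocalInv {n : ℕ} (t : ℕ) (c : ℕ → Bool) (p : Bool) (L : LState n) : Prop where
  idle_iff : L.pc = .idle ↔ L.round = 0
  support_zero : L.round = 0 → L.support = false
  first : L.round = 1 → L.s = !p ∧ L.support = false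
  s_coin : 2 ≤ L.round → L.s = c (L.round - 1)
  ptr_eq : 1 ≤ L.round → ∀ v, L.ptr v = lastPtr c L.round v
  called_iff : ∀ r v, (r, v) ∈ L.called ↔ r ≤ L.round ∧ Invoked c r v
  echo_sent : ∀ r v, (r, v) ∈ L.called → t + 1 ≤ (L.senders (.sval r v)).card →
    Msg.sval r v ∈ L.sent
  nodup : L.sent.Nodup
  sval_called : ∀ r v, Msg.sval r v ∈ L.sent → (r, v) ∈ L.called
  -- The instance is named by `lastPtr c r w` because `L.ptr w` may have moved on since round `r`.
  aux_sent : ∀ r w, Msg.aux r w ∈ L.sent → 1 ≤ r ∧ L.PastPtr r ∧ L.svalue t (lastPtr c r w) w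
  aux_unique : ∀ r w w', Msg.aux r w ∈ L.sent → Msg.aux r w' ∈ L.sent → w = w'
  aux_exists : ∀ r, 1 ≤ r → L.PastPtr r → ∃ w, Msg.aux r w ∈ L.sent
  aux_support : ∀ w, Msg.aux L.round w ∈ L.sent → L.support = true → w = L.s
  sval_proposal : 1 ≤ L.round → Msg.sval 1 p ∈ L.sent
  sval_noSupport : 1 ≤ L.round → L.support = false → Msg.sval L.round (!L.s) ∈ L.sent
  support_ptr : L.support = true → L.binptr t L.s
  coin_view : L.pc = .waitCoin → ∃ f, L.AuxQuorum t f ∧ ∀ v, v ∈ L.view ↔ ∃ j, f j = some v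
  decision_lt : ∀ r v, L.decision = some (r, v) → r < L.round

namespace LocalInv

open LState

variable {n t : ℕ} {c : ℕ → Bool} {p : Bool} {L : LState n}

lemma init : LocalInv t c p (LState.init : LState n) := by
  constructor <;> simp [LState.init, Invoked, PastPtr]; omega

lemma one_le_round (h : LocalInv t c p L) (hpc : L.pc ≠ .idle) : 1 ≤ L.round := by
  have := h.idle_iff.not.1 hpc; omega

lemma receive (h : LocalInv t c p L) (j : Fin n) (m : Msg) :
    LocalInv t c p (L.receive t j m) := by
  obtain ⟨X, hX, hm, hn⟩ := receive_spec t L j m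
  rw [hX] at hm ⊢
  have hsub : L.recv ⊆ insert (j, m) L.recv := Finset.subset_insert _ _
  have haux : ∀ r w, Msg.aux r w ∈ X ↔ Msg.aux r w ∈ L.sent := by
    intro r w; rw [hm]; simp
  have hmono : ∀ m', m' ∈ L.sent → m' ∈ X := fun m' h' => (hm m').2 (Or.inl h')
  constructor
  · exact h.idle_iff
  · exact h.support_zero
  · exact h.first
  · exact h.s_coin
  · exact h.ptr_eq
  · exact h.called_iff
  · intro r v hc hcard
    by_cases hmm : m = .sval r v
    · exact (hm _).2 (Or.inr ⟨r, v, hmm, rfl, hc, hcard⟩)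
    -- Any other message adds no sender to this instance, so the threshold had been reached before.
    · refine hmono _ (h.echo_sent r v hc (hcard.trans (Finset.card_le_card fun i hi => ?_)))
      simp only [mem_senders, Finset.mem_insert, Prod.mk.injEq] at hi ⊢
      exact hi.resolve_left fun h' => hmm h'.2.symm
  · exact hn h.nodup
  · intro r v hs
    rcases (hm _).1 hs with h' | ⟨r, v, -, h', h'', -⟩
    · exact h.sval_called r v h'
    · cases h'; exact h''
  · intro r w hw
    obtain ⟨h1, h2, h3⟩ := h.aux_sent r w ((haux r w).1 hw)
    exact ⟨h1, h2, svalue_mono (by rfl) hsub h3⟩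
  · intro r w w' h1 h2
    exact h.aux_unique r w w' ((haux _ _).1 h1) ((haux _ _).1 h2)
  · intro r hr hp
    obtain ⟨w, hw⟩ := h.aux_exists r hr hp
    exact ⟨w, hmono _ hw⟩
  · intro w hw
    exact h.aux_support w ((haux _ _).1 hw)
  · exact fun hr => hmono _ (h.sval_proposal hr)
  · exact fun hr hs => hmono _ (h.sval_noSupport hr hs)
  · exact fun hs => binptr_congr (L := L) (by rfl) id hsub (h.support_ptr hs)
  · intro hpc
    obtain ⟨f, hf, hv⟩ := h.coin_view hpc
    refine ⟨f, ⟨hf.1, fun j' v hj => ⟨hsub (hf.2 j' v hj).1, ?_⟩⟩, hv⟩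
    exact binptr_congr (L := L) (by rfl) id hsub (hf.2 j' v hj).2
  · exact h.decision_lt

lemma propose (h : LocalInv t c p L) (hpc : L.pc = .idle) : LocalInv t c p (L.propose t p) := by
  obtain ⟨X, hX, hm, hn⟩ := propose_spec t L p
  rw [hX]
  have h0 := h.idle_iff.1 hpc
  have hcalled : ∀ r v, (r, v) ∉ L.called := by
    intro r v hc
    have := (h.called_iff r v).1 hc
    have := this.2.1; omega
  have hsval : ∀ r v, Msg.sval r v ∉ L.sent := fun r v h' => hcalled _ _ (h.sval_called r v h')
  have hauxL : ∀ r v, Msg.aux r v ∉ L.sent := by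
    intro r v h'
    have := h.aux_sent r v h'
    simp only [PastPtr, hpc, h0] at this
    simp at this
  have haux : ∀ r v, Msg.aux r v ∉ X := by
    intro r v h'
    rw [hm] at h'
    simp [hauxL] at h'
  have hc : ∀ r v, (r, v) ∈ insert (1, p) (insert (1, !p) L.called) ↔ r = 1 := by
    intro r v
    simp only [Finset.mem_insert, hcalled, Prod.mk.injEq, or_false]
    cases v <;> cases p <;> simp
  constructor
  · simp
  · simp
  · simp
  · simp
  · intro _ v; simp [lastPtr]
  · intro r v
    simp only [hc, Invoked]
    constructor
    · rintro rfl; simp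
    · omega
  · intro r v h1 h2
    rw [hc] at h1; subst h1
    rw [hm]
    by_cases hv : v = p
    · simp [hv]
    · have : v = !p := Bool.eq_not_of_ne hv
      subst this
      exact Or.inr (Or.inr ⟨rfl, h2⟩)
  · exact hn h.nodup (hsval 1)
  · intro r v hs
    rw [hc]
    rw [hm] at hs
    simp only [hsval, Msg.sval.injEq] at hs
    tauto
  · exact fun r w hw => absurd hw (haux _ _)
  · exact fun r w w' hw => absurd hw (haux _ _)
  · intro r hr hp
    simp [PastPtr] at hp; omega
  · exact fun w hw => absurd hw (haux _ _)
  · exact fun _ => (hm _).2 (Or.inr (Or.inl rfl))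
  · intro _ _; simp [hm]
  · simp
  · simp
  · intro r v hd
    have := h.decision_lt r v hd; omega

lemma sendAux (h : LocalInv t c p L) (hpc : L.pc = .waitPtr) (hr : L.ptrReady t) :
    LocalInv t c p (L.sendAux t) := by
  have h1 : 1 ≤ L.round := h.one_le_round (by simp [hpc])
  have hb := binptr_auxValue h.support_ptr hr
  have hL : ∀ w, Msg.aux L.round w ∉ L.sent := by
    intro w hw
    have := (h.aux_sent _ _ hw).2.1
    simp [PastPtr, hpc] at this
  have hpast : ∀ r, (L.sendAux t).PastPtr r ↔ L.PastPtr r ∨ r = L.round := by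
    intro r; simp [PastPtr, LState.sendAux, bcast, hpc]
  constructor
  · simp [LState.sendAux, bcast]; omega
  · exact h.support_zero
  · exact h.first
  · exact h.s_coin
  · exact h.ptr_eq
  · exact h.called_iff
  · exact fun r v h1 h2 => List.mem_cons_of_mem _ (h.echo_sent r v h1 h2)
  · exact List.nodup_cons.2 ⟨hL _, h.nodup⟩
  · intro r v hs
    simp [LState.sendAux, bcast] at hs
    exact h.sval_called r v hs
  · intro r w hw
    simp only [LState.sendAux, bcast, List.mem_cons, Msg.aux.injEq] at hw
    rw [hpast]
    rcases hw with ⟨rfl, rfl⟩ | hw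
    · refine ⟨h1, Or.inr rfl, ?_⟩
      rw [← h.ptr_eq h1]
      exact hb
    · have := h.aux_sent r w hw
      exact ⟨this.1, Or.inl this.2.1, this.2.2⟩
  · intro r w w' hw hw'
    simp only [LState.sendAux, bcast, List.mem_cons, Msg.aux.injEq] at hw hw'
    rcases hw with ⟨rfl, rfl⟩ | hw <;> rcases hw' with ⟨h', rfl⟩ | hw'
    · rfl
    · exact absurd hw' (hL _)
    · subst h'; exact absurd hw (hL _)
    · exact h.aux_unique r w w' hw hw'
  · intro r hr hp
    rw [hpast] at hp
    rcases hp with hp | rfl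
    · obtain ⟨w, hw⟩ := h.aux_exists r hr hp
      exact ⟨w, List.mem_cons_of_mem _ hw⟩
    · exact ⟨_, List.mem_cons_self⟩
  · intro w hw hs
    simp only [LState.sendAux, bcast, List.mem_cons, Msg.aux.injEq, true_and] at hw hs ⊢
    rcases hw with rfl | hw
    · simp [auxValue, hs]
    · exact absurd hw (hL _)
  · exact fun hr => List.mem_cons_of_mem _ (h.sval_proposal hr)
  · exact fun hr hs => List.mem_cons_of_mem _ (h.sval_noSupport hr hs)
  · exact h.support_ptr
  · simp [LState.sendAux]
  · exact h.decision_lt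

lemma callCoin (h : LocalInv t c p L) (hpc : L.pc = .waitAux) {f : Fin n → Option Bool}
    (hf : L.AuxQuorum t f) : LocalInv t c p (L.callCoin f) := by
  have h1 : 1 ≤ L.round := h.one_le_round (by simp [hpc])
  have hpast : ∀ r, (L.callCoin f).PastPtr r ↔ L.PastPtr r := by
    intro r; simp [PastPtr, LState.callCoin, hpc]
  constructor
  · simp [LState.callCoin]; omega
  · exact h.support_zero
  · exact h.first
  · exact h.s_coin
  · exact h.ptr_eq
  · exact h.called_iff
  · exact h.echo_sent
  · exact h.nodup
  · exact h.sval_called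
  · intro r w hw; rw [hpast]; exact h.aux_sent r w hw
  · exact h.aux_unique
  · intro r hr hp; rw [hpast] at hp; exact h.aux_exists r hr hp
  · exact h.aux_support
  · exact h.sval_proposal
  · exact h.sval_noSupport
  · exact h.support_ptr
  · exact fun _ => ⟨f, hf, by simp [LState.callCoin]⟩
  · exact h.decision_lt

lemma view_binptr (h : LocalInv t c p L) (hpc : L.pc = .waitCoin) {v : Bool} (hv : v ∈ L.view) :
    L.binptr t v := by
  obtain ⟨f, hf, hv'⟩ := h.coin_view hpc
  obtain ⟨j, hj⟩ := (hv' v).1 hv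
  exact (hf.2 j v hj).2

lemma coinReturn (h : LocalInv t c p L) (hpc : L.pc = .waitCoin) :
    LocalInv t c p (L.coinReturn t (c L.round)) := by
  have h1 : 1 ≤ L.round := h.one_le_round (by simp [hpc])
  rw [coinReturn_eq]
  obtain ⟨X, hX, hm, hn⟩ := newRound_spec t (L.endRound (c L.round))
  rw [hX]
  dsimp only [endRound] at hm hn ⊢
  -- Support puts the coin in the view, and values in the view have true pointers. This yields
  -- `support_ptr` for the next round, which replaces only the pointer of the opposite value.
  have hsupp : nextSupport L.view (c L.round) = true → c L.round ∈ L.view := by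
    simp only [nextSupport, decide_eq_true_eq]
    rintro (h | h) <;> rw [h]
    · simp
    · cases c L.round <;> simp
  have hauxX : ∀ r w, Msg.aux r w ∈ X ↔ Msg.aux r w ∈ L.sent := by
    intro r w; rw [hm]; simp
  have hmono : ∀ m', m' ∈ L.sent → m' ∈ X := fun m' h' => (hm m').2 (Or.inl h')
  -- An instance of the next round has not been invoked yet, so its initial broadcast is no
  -- repetition.
  have hnot : ∀ v, Msg.sval (L.round + 1) v ∉ L.sent := by
    intro v hv
    have := ((h.called_iff _ _).1 (h.sval_called _ _ hv)).1
    omega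
  constructor
  · simp
  · simp
  · simp; omega
  · simp
  · intro _ v
    dsimp only
    rw [lastPtr, Function.update_apply]
    by_cases hv : v = !c L.round
    · subst hv
      simp
    · have : v = c L.round := by simpa using Bool.eq_not_of_ne hv
      subst this
      simp [h1, h.ptr_eq h1]
  · intro r v
    simp only [Finset.mem_insert, Prod.mk.injEq, h.called_iff]
    constructor
    · rintro (⟨rfl, rfl⟩ | ⟨h2, h3⟩)
      · simp [Invoked]
      · exact ⟨by omega, h3⟩
    · rintro ⟨h2, h3⟩
      rcases Nat.lt_or_ge L.round r with h4 | h4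
      · left
        have : r = L.round + 1 := by omega
        subst this
        refine ⟨rfl, ?_⟩
        simpa [show L.round ≠ 0 by omega] using h3.2
      · exact Or.inr ⟨h4, h3⟩
  · intro r v hc hcard
    simp only [Finset.mem_insert, Prod.mk.injEq] at hc
    rcases hc with ⟨rfl, rfl⟩ | hc
    · exact (hm _).2 (Or.inr ⟨rfl, Or.inr hcard⟩)
    · exact hmono _ (h.echo_sent r v hc hcard)
  · exact hn h.nodup (hnot _)
  · intro r v hs
    rw [Finset.mem_insert]
    rcases (hm _).1 hs with h' | ⟨h', -⟩
    · exact Or.inr (h.sval_called r v h')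
    · cases h'; exact Or.inl rfl
  · intro r w hw
    obtain ⟨h2, h3, h4⟩ := h.aux_sent r w ((hauxX r w).1 hw)
    refine ⟨h2, Or.inl ?_, svalue_mono (Finset.subset_insert _ _) (by rfl) h4⟩
    rcases h3 with h3 | h3 <;> dsimp only <;> omega
  · intro r w w' h1 h2
    exact h.aux_unique r w w' ((hauxX _ _).1 h1) ((hauxX _ _).1 h2)
  · intro r hr hp
    have : L.PastPtr r := by
      simp only [PastPtr, reduceCtorEq, or_self, and_false, or_false] at hp
      rcases Nat.lt_or_ge r L.round with h5 | h5
      · exact Or.inl h5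
      · exact Or.inr ⟨by omega, Or.inr hpc⟩
    obtain ⟨w, hw⟩ := h.aux_exists r hr this
    exact ⟨w, hmono _ hw⟩
  · intro w hw
    have := (h.aux_sent _ w ((hauxX _ _).1 hw)).2.1
    exfalso
    rcases this with h' | h' <;> dsimp only at h' <;> omega
  · exact fun _ => hmono _ (h.sval_proposal h1)
  · exact fun _ hs => (hm _).2 (Or.inr ⟨rfl, Or.inl hs⟩)
  · intro hs
    refine binptr_congr (L := L) ?_ (fun h' => Finset.mem_insert_of_mem h') (by rfl)
      (h.view_binptr hpc (hsupp hs))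
    dsimp only
    rw [Function.update_of_ne]
    cases c L.round <;> simp
  · simp
  · intro r v hd
    dsimp only at hd ⊢
    split_ifs at hd with h'
    · simp at hd; omega
    · have := h.decision_lt r v hd; omega

lemma step (h : LocalInv t c p L) {ok : Fin n → Msg → Prop} {coin : ℕ → Option Bool}
    (hcoin : ∀ b, coin L.round = some b → b = c L.round) {L' : LState n}
    (hs : LState.Step t p ok coin L L') : LocalInv t c p L' := by
  cases hs with
  | refl => exact h
  | receive j m _ => exact h.receive j m
  | propose hpc => exact h.propose hpc
  | sendAux hpc hr => exact h.sendAux hpc hr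
  | callCoin f hpc hf => exact h.callCoin hpc hf
  | coinReturn b hpc hb => rw [hcoin b hb]; exact h.coinReturn hpc

end LocalInv

/-! ### Effects of a single local step, and a measure of progress. -/

namespace LState

variable {n t : ℕ} {p : Bool} {ok : Fin n → Msg → Prop} {coin : ℕ → Option Bool} {L L' : LState n}

/-- The process has called `random()` in round `r`. -/
def PastAux (L : LState n) (r : ℕ) : Prop := r < L.round ∨ (r = L.round ∧ L.pc = .waitCoin)

/-- Progress of the main thread. -/
def rank (L : LState n) : ℕ :=
  -- The factor exceeds every offset, so ranks of different rounds do not overlap. `idle` and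
  -- `waitPtr` can share an offset because `idle` occurs only in round 0 and `waitPtr` only later.
  4 * L.round + match L.pc with
    | .idle => 0
    | .waitPtr => 0
    | .waitAux => 1
    | .waitCoin => 2

/-- Equality of all that only the main thread changes. -/
def SameMain (L L' : LState n) : Prop :=
  L'.pc = L.pc ∧ L'.round = L.round ∧ L'.s = L.s ∧ L'.support = L.support ∧ L'.view = L.view ∧
    L'.decision = L.decision

lemma SameMain.refl (L : LState n) : SameMain L L := ⟨rfl, rfl, rfl, rfl, rfl, rfl⟩

lemma SameMain.trans {L'' : LState n} (h : SameMain L L') (h' : SameMain L' L'') :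
    SameMain L L'' := by
  obtain ⟨h1, h2, h3, h4, h5, h6⟩ := h
  obtain ⟨h1', h2', h3', h4', h5', h6'⟩ := h'
  exact ⟨h1'.trans h1, h2'.trans h2, h3'.trans h3, h4'.trans h4, h5'.trans h5, h6'.trans h6⟩

lemma receive_sameMain (t : ℕ) (L : LState n) (j : Fin n) (m : Msg) :
    SameMain L (L.receive t j m) := by
  obtain ⟨X, hX, -, -⟩ := receive_spec t L j m
  rw [hX]; exact ⟨rfl, rfl, rfl, rfl, rfl, rfl⟩

lemma coinReturn_fields (t : ℕ) (L : LState n) (b : Bool) :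
    (L.coinReturn t b).pc = .waitPtr ∧ (L.coinReturn t b).round = L.round + 1 ∧
    (L.coinReturn t b).s = b ∧ (L.coinReturn t b).support = nextSupport L.view b ∧
    (L.coinReturn t b).decision =
      (if L.view = {b} ∧ L.decision = none then some (L.round, b) else L.decision) := by
  rw [coinReturn_eq]
  obtain ⟨X, hX, -, -⟩ := newRound_spec t (L.endRound b)
  rw [hX]; exact ⟨rfl, rfl, rfl, rfl, rfl⟩

lemma propose_fields (t : ℕ) (L : LState n) (v : Bool) :
    (L.propose t v).pc = .waitPtr ∧ (L.propose t v).round = 1 ∧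
    (L.propose t v).decision = L.decision := by
  obtain ⟨X, hX, -, -⟩ := propose_spec t L v
  rw [hX]; exact ⟨rfl, rfl, rfl⟩

namespace Step

lemma recv_cases (h : Step t p ok coin L L') (j : Fin n) (m : Msg) (hj : (j, m) ∈ L'.recv) :
    (j, m) ∈ L.recv ∨ ok j m := by
  cases h with
  | refl => exact Or.inl hj
  | receive j' m' hok =>
    obtain ⟨X, hX, -, -⟩ := receive_spec t L j' m'
    rw [hX] at hj
    simp only [Finset.mem_insert, Prod.mk.injEq] at hj
    rcases hj with ⟨rfl, rfl⟩ | hj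
    · exact Or.inr hok
    · exact Or.inl hj
  | propose _ =>
    obtain ⟨X, hX, -, -⟩ := propose_spec t L p
    rw [hX] at hj; exact Or.inl hj
  | sendAux _ _ => exact Or.inl hj
  | callCoin f _ _ => exact Or.inl hj
  | coinReturn b _ _ =>
    rw [coinReturn_eq] at hj
    obtain ⟨X, hX, -, -⟩ := newRound_spec t (L.endRound b)
    rw [hX] at hj; exact Or.inl hj

lemma recv_subset (h : Step t p ok coin L L') : L.recv ⊆ L'.recv := by
  cases h with
  | refl => rfl
  | receive j' m' hok =>
    obtain ⟨X, hX, -, -⟩ := receive_spec t L j' m'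
    rw [hX]; exact Finset.subset_insert _ _
  | propose _ =>
    obtain ⟨X, hX, -, -⟩ := propose_spec t L p
    rw [hX]
  | sendAux _ _ => rfl
  | callCoin f _ _ => rfl
  | coinReturn b _ _ =>
    rw [coinReturn_eq]
    obtain ⟨X, hX, -, -⟩ := newRound_spec t (L.endRound b)
    rw [hX]; rfl

lemma sent_subset (h : Step t p ok coin L L') {m : Msg} (hm : m ∈ L.sent) : m ∈ L'.sent := by
  cases h with
  | refl => exact hm
  | receive j' m' hok =>
    obtain ⟨X, hX, hXm, -⟩ := receive_spec t L j' m'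
    rw [hX]; exact (hXm _).2 (Or.inl hm)
  | propose _ =>
    obtain ⟨X, hX, hXm, -⟩ := propose_spec t L p
    rw [hX]; exact (hXm _).2 (Or.inl hm)
  | sendAux _ _ => exact List.mem_cons_of_mem _ hm
  | callCoin f _ _ => exact hm
  | coinReturn b _ _ =>
    rw [coinReturn_eq]
    obtain ⟨X, hX, hXm, -⟩ := newRound_spec t (L.endRound b)
    rw [hX]; exact (hXm _).2 (Or.inl hm)

lemma decision_mono (h : Step t p ok coin L L') {x : ℕ × Bool} (hx : L.decision = some x) :
    L'.decision = some x := by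
  cases h with
  | refl => exact hx
  | receive j' m' hok => rw [(receive_sameMain t L j' m').2.2.2.2.2, hx]
  | propose _ => rw [(propose_fields t L p).2.2, hx]
  | sendAux _ _ => exact hx
  | callCoin f _ _ => exact hx
  | coinReturn b _ _ => rw [(coinReturn_fields t L b).2.2.2.2]; simp [hx]

/-- Receptions do not touch the main thread, and each step of it moves forward. Equal ranks at two
times hence mean that the main thread did nothing in between. -/
lemma sameMain_or_rank_lt (h : Step t p ok coin L L') (h0 : L.pc = .idle → L.round = 0) :
    SameMain L L' ∨ L.rank < L'.rank := by
  cases h with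
  | refl => exact Or.inl (SameMain.refl L)
  | receive j' m' hok => exact Or.inl (receive_sameMain t L j' m')
  | propose hpc =>
    right
    simp [rank, (propose_fields t L p).1, (propose_fields t L p).2.1, hpc, h0 hpc]
  | sendAux hpc _ => right; simp [rank, LState.sendAux, bcast, hpc]
  | callCoin f hpc _ => right; simp [rank, LState.callCoin, hpc]
  | coinReturn b hpc _ =>
    right
    simp only [rank, (coinReturn_fields t L b).1, (coinReturn_fields t L b).2.1, hpc]
    omega

/-- A new SVAL has one of two causes: an echo, or the start of a round without support (`propose`
included). -/
lemma sval_sent_cases (h : Step t p ok coin L L') {r : ℕ} {v : Bool}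
    (hm : Msg.sval r v ∈ L'.sent) :
    Msg.sval r v ∈ L.sent ∨ t + 1 ≤ (L'.senders (.sval r v)).card ∨
      (L'.round = r ∧ L'.s = !v ∧ L'.support = false) := by
  cases h with
  | refl => exact Or.inl hm
  | receive j' m' hok =>
    obtain ⟨X, hX, hXm, -⟩ := receive_spec t L j' m'
    rw [hX] at hm
    rcases (hXm _).1 hm with h | ⟨r', v', -, h', -, h''⟩
    · exact Or.inl h
    · cases h'; exact Or.inr (Or.inl h'')
  | propose _ =>
    obtain ⟨X, hX, hXm, -⟩ := propose_spec t L p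
    rw [hX] at hm ⊢
    rcases (hXm _).1 hm with h | h' | ⟨h', h''⟩
    · exact Or.inl h
    · cases h'; exact Or.inr (Or.inr ⟨rfl, rfl, rfl⟩)
    · cases h'; exact Or.inr (Or.inl h'')
  | sendAux _ _ => exact Or.inl (by simpa [LState.sendAux, bcast] using hm)
  | callCoin f _ _ => exact Or.inl hm
  | coinReturn b _ _ =>
    rw [coinReturn_eq] at hm ⊢
    obtain ⟨X, hX, hXm, -⟩ := newRound_spec t (L.endRound b)
    rw [hX] at hm ⊢
    rcases (hXm _).1 hm with h | ⟨h', h | h⟩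
    · exact Or.inl h
    · cases h'; exact Or.inr (Or.inr ⟨rfl, by simp, h⟩)
    · cases h'; exact Or.inr (Or.inl h)

lemma aux_sent_cases (h : Step t p ok coin L L') {r : ℕ} {w : Bool}
    (hm : Msg.aux r w ∈ L'.sent) : Msg.aux r w ∈ L.sent ∨ L'.round = r := by
  cases h with
  | refl => exact Or.inl hm
  | receive j' m' hok =>
    obtain ⟨X, hX, hXm, -⟩ := receive_spec t L j' m'
    rw [hX] at hm
    rcases (hXm _).1 hm with h | ⟨r', v', -, h', -, h''⟩
    · exact Or.inl h
    · cases h'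
  | propose _ =>
    obtain ⟨X, hX, hXm, -⟩ := propose_spec t L p
    rw [hX] at hm
    rw [hXm] at hm
    exact Or.inl (by simpa using hm)
  | sendAux _ _ =>
    simp only [LState.sendAux, bcast, List.mem_cons, Msg.aux.injEq] at hm ⊢
    exact hm.symm.imp id fun h => h.1.symm
  | callCoin f _ _ => exact Or.inl hm
  | coinReturn b _ _ =>
    rw [coinReturn_eq] at hm
    obtain ⟨X, hX, hXm, -⟩ := newRound_spec t (L.endRound b)
    rw [hX] at hm
    rw [hXm] at hm
    exact Or.inl (by simpa [endRound] using hm)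

lemma decision_cases (h : Step t p ok coin L L') {r : ℕ} {v : Bool}
    (hd : L'.decision = some (r, v)) :
    L.decision = some (r, v) ∨
      (L.pc = .waitCoin ∧ L.round = r ∧ L.view = {v} ∧ coin r = some v) := by
  cases h with
  | refl => exact Or.inl hd
  | receive j' m' hok => rw [(receive_sameMain t L j' m').2.2.2.2.2] at hd; exact Or.inl hd
  | propose _ => rw [(propose_fields t L p).2.2] at hd; exact Or.inl hd
  | sendAux _ _ => exact Or.inl hd
  | callCoin f _ _ => exact Or.inl hd
  | coinReturn b hpc hb =>
    rw [(coinReturn_fields t L b).2.2.2.2] at hd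
    split_ifs at hd with h
    · simp only [Option.some.injEq, Prod.mk.injEq] at hd
      obtain ⟨rfl, rfl⟩ := hd
      exact Or.inr ⟨hpc, rfl, h.1, hb⟩
    · exact Or.inl hd

lemma round_cases (h : Step t p ok coin L L') :
    (L'.round = L.round ∧ L'.s = L.s ∧ L'.support = L.support) ∨ (L.pc = .idle ∧ L'.round = 1) ∨
      (L.pc = .waitCoin ∧ ∃ b, coin L.round = some b ∧ L' = L.coinReturn t b) := by
  cases h with
  | refl => exact Or.inl ⟨rfl, rfl, rfl⟩
  | receive j' m' hok =>
    obtain ⟨-, h1, h2, h3, -⟩ := receive_sameMain t L j' m'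
    exact Or.inl ⟨h1, h2, h3⟩
  | propose hpc => exact Or.inr (Or.inl ⟨hpc, (propose_fields t L p).2.1⟩)
  | sendAux _ _ => exact Or.inl ⟨rfl, rfl, rfl⟩
  | callCoin f _ _ => exact Or.inl ⟨rfl, rfl, rfl⟩
  | coinReturn b hpc hb => exact Or.inr (Or.inr ⟨hpc, b, hb, rfl⟩)

end Step

end LState

/-! ### Global configurations and their invariant. -/

open LState

variable {n t : ℕ} {F : Finset (Fin n)} {prop : Fin n → Bool} {c : ℕ → Bool}

lemma Config.setLoc_loc (C : Config n) (i j : Fin n) (L : LState n) :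
    (C.setLoc i L).loc j = if j = i then L else C.loc j := by
  simp [Config.setLoc, Function.update_apply]

lemma Config.ask_asked (C : Config n) (i : Fin n) (r r' : ℕ) :
    (C.ask t c i r).asked r' = if r' = r then insert i (C.asked r) else C.asked r' := by
  simp [Config.ask, Function.update_apply]

lemma Config.ask_coin (C : Config n) (i : Fin n) (r r' : ℕ) :
    (C.ask t c i r).coin r' =
      if r' = r ∧ t + 1 ≤ (insert i (C.asked r)).card then some (c r) else C.coin r' := by
  simp only [Config.ask]
  by_cases h : t + 1 ≤ (insert i (C.asked r)).card <;> simp [h, Function.update_apply]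

/-- The local effect of an event on a process. -/
lemma Config.step_loc (C : Config n) (a : Action n) (i : Fin n) :
    LState.Step t (prop i) (fun j m => j ∈ F ∨ m ∈ (C.loc j).sent) C.coin (C.loc i)
      ((C.step t F prop c a).loc i) := by
  cases a with
  | skip => exact .refl
  | deliver i' j m =>
    simp only [Config.step]
    split_ifs with h
    · rw [Config.setLoc_loc]
      split_ifs with h'
      · subst h'; exact .receive _ _ (h.imp id And.left)
      · exact .refl
    · exact .refl
  | propose i' =>
    simp only [Config.step]
    split_ifs with h
    · rw [Config.setLoc_loc]
      split_ifs with h'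
      · subst h'; exact .propose h.2
      · exact .refl
    · exact .refl
  | sendAux i' =>
    simp only [Config.step]
    split_ifs with h
    · rw [Config.setLoc_loc]
      split_ifs with h'
      · subst h'; exact .sendAux h.2.1 h.2.2
      · exact .refl
    · exact .refl
  | callCoin i' f =>
    simp only [Config.step]
    split_ifs with h
    · rw [Config.ask, Config.setLoc_loc]
      split_ifs with h'
      · subst h'; exact .callCoin f h.2.1 h.2.2
      · exact .refl
    · exact .refl
  | coinReturn i' =>
    simp only [Config.step]
    split_ifs with h
    · split
      · rename_i b hb
        rw [Config.setLoc_loc]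
        split_ifs with h'
        · subst h'; exact .coinReturn b h.2 hb
        · exact .refl
      · exact .refl
    · exact .refl

/-- The effect of an event on the common coin. -/
lemma Config.step_coin (C : Config n) (a : Action n)
    (h0 : ∀ i ∉ F, (C.loc i).pc = .idle → (C.loc i).round = 0) :
    ((C.step t F prop c a).asked = C.asked ∧ (C.step t F prop c a).coin = C.coin ∧
      ∀ i ∉ F, ∀ r, 1 ≤ r → (((C.step t F prop c a).loc i).PastAux r ↔ (C.loc i).PastAux r)) ∨
    ∃ i f, i ∉ F ∧ (C.loc i).pc = .waitAux ∧
      C.step t F prop c a = (C.setLoc i ((C.loc i).callCoin f)).ask t c i (C.loc i).round := by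
  cases a with
  | skip => exact Or.inl ⟨rfl, rfl, fun i hi r hr => Iff.rfl⟩
  | deliver i' j m =>
    left
    simp only [Config.step]
    split_ifs with h
    · refine ⟨rfl, rfl, fun i hi r hr => ?_⟩
      rw [Config.setLoc_loc]
      split_ifs with h'
      · subst h'
        have := receive_sameMain t (C.loc i) i' m
        simp [PastAux, this.1, this.2.1]
      · rfl
    · exact ⟨rfl, rfl, fun i hi r hr => Iff.rfl⟩
  | propose i' =>
    left
    simp only [Config.step]
    split_ifs with h
    · refine ⟨rfl, rfl, fun i hi r hr => ?_⟩
      rw [Config.setLoc_loc]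
      split_ifs with h'
      · subst h'
        have := propose_fields t (C.loc i) (prop i)
        simp [PastAux, this.1, this.2.1, h.2, h0 i hi h.2]; omega
      · rfl
    · exact ⟨rfl, rfl, fun i hi r hr => Iff.rfl⟩
  | sendAux i' =>
    left
    simp only [Config.step]
    split_ifs with h
    · refine ⟨rfl, rfl, fun i hi r hr => ?_⟩
      rw [Config.setLoc_loc]
      split_ifs with h'
      · subst h'
        simp [PastAux, LState.sendAux, bcast, h.2.1]
      · rfl
    · exact ⟨rfl, rfl, fun i hi r hr => Iff.rfl⟩
  | callCoin i' f =>
    by_cases h : i' ∉ F ∧ (C.loc i').pc = .waitAux ∧ (C.loc i').AuxQuorum t f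
    · right
      exact ⟨i', f, h.1, h.2.1, by rw [Config.step, if_pos h]⟩
    · left
      rw [Config.step, if_neg h]
      exact ⟨rfl, rfl, fun i hi r hr => Iff.rfl⟩
  | coinReturn i' =>
    left
    simp only [Config.step]
    split_ifs with h
    · split
      · rename_i b hb
        refine ⟨rfl, rfl, fun i hi r hr => ?_⟩
        rw [Config.setLoc_loc]
        split_ifs with h'
        · subst h'
          have := coinReturn_fields t (C.loc i) b
          simp [PastAux, this.1, this.2.1, h.2]; omega
        · rfl
      · exact ⟨rfl, rfl, fun i hi r hr => Iff.rfl⟩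
    · exact ⟨rfl, rfl, fun i hi r hr => Iff.rfl⟩

/-- What holds of every reachable configuration. -/
structure GlobalInv (t : ℕ) (F : Finset (Fin n)) (prop : Fin n → Bool) (c : ℕ → Bool)
    (C : Config n) : Prop where
  loc : ∀ i ∉ F, LocalInv t c (prop i) (C.loc i)
  recv : ∀ i ∉ F, ∀ j ∉ F, ∀ m, (j, m) ∈ (C.loc i).recv → m ∈ (C.loc j).sent
  -- Round 0 has no call of `random()`, although every started process is past it.
  asked_iff : ∀ i r, i ∈ C.asked r ↔ i ∉ F ∧ 1 ≤ r ∧ (C.loc i).PastAux r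
  coin_eq : ∀ r, C.coin r = if t + 1 ≤ (C.asked r).card then some (c r) else none
  -- While the coin of round `r` is hidden, no non-faulty process is beyond round `r`; the
  -- independence of early views from that coin depends on this.
  coin_prev : ∀ i ∉ F, ∀ r, 1 ≤ r → r < (C.loc i).round → C.coin r ≠ none

namespace GlobalInv

variable {C : Config n}

lemma init : GlobalInv t F prop c (Config.init : Config n) := by
  constructor
  · exact fun i _ => LocalInv.init
  · intro i _ j _ m; simp [Config.init, LState.init]
  · simp [Config.init, LState.init, PastAux]
  · simp [Config.init]
  · simp [Config.init, LState.init]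

lemma coin_some (h : GlobalInv t F prop c C) {r : ℕ} {b : Bool} (hb : C.coin r = some b) :
    b = c r := by
  rw [h.coin_eq] at hb
  split_ifs at hb
  simpa using hb.symm

lemma coin_mono (h : GlobalInv t F prop c C) (a : Action n) {r : ℕ} (hr : C.coin r ≠ none) :
    (C.step t F prop c a).coin r ≠ none := by
  rcases C.step_coin a (fun i hi => (h.loc i hi).idle_iff.1) (t := t) (prop := prop) (c := c) with
    ⟨-, h2, -⟩ | ⟨i, f, -, -, h4⟩
  · rw [h2]; exact hr
  · rw [h4, Config.ask_coin]
    split_ifs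
    · simp
    · exact hr

lemma step (h : GlobalInv t F prop c C) (a : Action n) :
    GlobalInv t F prop c (C.step t F prop c a) := by
  have hloc : ∀ i ∉ F, LocalInv t c (prop i) ((C.step t F prop c a).loc i) := fun i hi =>
    (h.loc i hi).step (fun b hb => h.coin_some hb) (C.step_loc a i)
  have hask : (∀ i r, i ∈ (C.step t F prop c a).asked r ↔
      i ∉ F ∧ 1 ≤ r ∧ ((C.step t F prop c a).loc i).PastAux r) ∧
      ∀ r, (C.step t F prop c a).coin r =
        if t + 1 ≤ ((C.step t F prop c a).asked r).card then some (c r) else none := by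
    rcases C.step_coin a (fun i hi => (h.loc i hi).idle_iff.1) (t := t) (prop := prop) (c := c)
      with ⟨h1, h2, h3⟩ | ⟨i, f, hi, hpc, h4⟩
    · constructor
      · intro i r
        rw [h1, h.asked_iff]
        constructor
        · exact fun ⟨h4, h5, h6⟩ => ⟨h4, h5, (h3 i h4 r h5).2 h6⟩
        · exact fun ⟨h4, h5, h6⟩ => ⟨h4, h5, (h3 i h4 r h5).1 h6⟩
      · intro r
        rw [h1, h2, h.coin_eq]
    · rw [h4]
      have h1 : 1 ≤ (C.loc i).round := (h.loc i hi).one_le_round (by simp [hpc])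
      constructor
      · intro j r
        simp only [Config.ask, Config.setLoc_loc]
        rw [Function.update_apply]
        have hj := h.asked_iff j r
        by_cases hr : r = (C.loc i).round
        · subst hr
          by_cases hji : j = i
          · subst hji
            simp [PastAux, LState.callCoin, Config.setLoc, hi, h1]
          · simp [Config.setLoc, hj, hji]
        · by_cases hji : j = i
          · subst hji
            simp [hr, Config.setLoc, hj, PastAux, LState.callCoin]
          · simp [Config.setLoc, hj, hji, hr]
      · intro r
        rw [Config.ask_coin, Config.ask_asked]
        by_cases hr : r = (C.loc i).round
        · subst hr
          simp only [true_and, if_true]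
          split_ifs with h5
          · rfl
          · simp only [Config.setLoc] at h5 ⊢
            rw [h.coin_eq, if_neg]
            intro h6
            exact h5 (h6.trans (Finset.card_le_card (Finset.subset_insert _ _)))
        · simp only [hr, false_and, if_false]
          exact h.coin_eq r
  refine ⟨hloc, ?_, hask.1, hask.2, ?_⟩
  · intro i hi j hj m hm
    refine (C.step_loc a j).sent_subset ?_
    rcases (C.step_loc a i).recv_cases j m hm with h' | h'
    · exact h.recv i hi j hj m h'
    · exact h'.resolve_left hj
  · intro i hi r hr hlt
    apply h.coin_mono
    rcases (C.step_loc a i).round_cases with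
      ⟨h1, -⟩ | ⟨-, h1⟩ | ⟨hpc, b, hb, h1⟩
    · exact h.coin_prev i hi r hr (h1 ▸ hlt)
    · omega
    · rw [h1, (coinReturn_fields _ _ _).2.1] at hlt
      rcases Nat.lt_succ_iff_lt_or_eq.1 hlt with h2 | rfl
      · exact h.coin_prev i hi r hr h2
      · simp [hb]

end GlobalInv

open LState

lemma mem_of_ne_not_mem {X : Finset Bool} {v : Bool} (h : X.Nonempty) (h' : (!v) ∉ X) :
    X = {v} := by
  revert X v; decide

lemma nextSupport_of_mem {X : Finset Bool} {b : Bool} (h : b ∈ X) : nextSupport X b = true := by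
  revert X b; decide

lemma lastPtr_succ_not (c : ℕ → Bool) (r : ℕ) : lastPtr c (r + 1) (!c r) = r + 1 := by
  simp [lastPtr]

lemma lastPtr_succ_self (c : ℕ → Bool) {r : ℕ} (hr : 1 ≤ r) :
    lastPtr c (r + 1) (c r) = lastPtr c r (c r) := by
  simp [lastPtr, hr]

/-! ### Executions, quorum intersection and the absence of unsupported values. -/

section Runs

variable {n t : ℕ} {F : Finset (Fin n)} {prop : Fin n → Bool} {A : Adversary n} {c : ℕ → Bool}

/-- The intersection has at least `n - 2t > t` elements, more than `F`. -/
lemma exists_mem_inter_notMem (ht : 3 * t < n) (hF : F.card ≤ t) {S T : Finset (Fin n)}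
    (hS : S.card = n - t) (hT : T.card = n - t) : ∃ j ∈ S, j ∈ T ∧ j ∉ F := by
  by_contra! h
  have h1 : S ∩ T ⊆ F := fun j hj => h j (Finset.mem_inter.1 hj).1 (Finset.mem_inter.1 hj).2
  have h2 := Finset.card_le_card h1
  have h3 := Finset.card_union_add_card_inter S T
  have h4 := (Finset.card_le_univ (S ∪ T)).trans_eq (Fintype.card_fin n)
  omega

lemma exists_mem_of_card {S T : Finset (Fin n)} (hS : S.card = n - t) (hT : t + 1 ≤ T.card)
    (ht : t < n) : ∃ j ∈ S, j ∈ T := by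
  by_contra! h
  have h1 : S ∩ T = ∅ := by
    ext j; simpa using h j
  have h3 := Finset.card_union_add_card_inter S T
  have h4 := (Finset.card_le_univ (S ∪ T)).trans_eq (Fintype.card_fin n)
  rw [h1, Finset.card_empty] at h3
  omega

lemma run_globalInv (k : ℕ) : GlobalInv t F prop c (run t F prop A c k).2 := by
  induction k with
  | zero => exact GlobalInv.init
  | succ k ih => exact ih.step _

lemma localAt_inv {i : Fin n} (hi : i ∉ F) (k : ℕ) :
    LocalInv t c (prop i) (localAt t F prop A c k i) :=
  (run_globalInv k).loc i hi

lemma localAt_step (k : ℕ) (i : Fin n) :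
    LState.Step t (prop i) (fun j m => j ∈ F ∨ m ∈ (localAt t F prop A c k j).sent)
      (run t F prop A c k).2.coin (localAt t F prop A c k i) (localAt t F prop A c (k + 1) i) :=
  Config.step_loc _ _ i

lemma localAt_zero (i : Fin n) : localAt t F prop A c 0 i = LState.init := rfl

lemma sent_mono {k k' : ℕ} (h : k ≤ k') {i : Fin n} {m : Msg}
    (hm : m ∈ (localAt t F prop A c k i).sent) : m ∈ (localAt t F prop A c k' i).sent := by
  induction k', h using Nat.le_induction with
  | base => exact hm
  | succ k' _ ih => exact (localAt_step k' i).sent_subset ih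

lemma recv_mono (i : Fin n) : Monotone fun k => (localAt t F prop A c k i).recv :=
  monotone_nat_of_le_succ fun k => (localAt_step k i).recv_subset

lemma decision_mono {k k' : ℕ} (h : k ≤ k') {i : Fin n} {x : ℕ × Bool}
    (hx : (localAt t F prop A c k i).decision = some x) :
    (localAt t F prop A c k' i).decision = some x := by
  induction k', h using Nat.le_induction with
  | base => exact hx
  | succ k' _ ih => exact (localAt_step k' i).decision_mono ih

lemma rank_mono {i : Fin n} (hi : i ∉ F) : Monotone fun k => (localAt t F prop A c k i).rank :=
  monotone_nat_of_le_succ fun k => by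
    rcases (localAt_step (A := A) (c := c) (F := F) (prop := prop) (t := t) k i).sameMain_or_rank_lt
      (localAt_inv hi k).idle_iff.1 with h | h
    · exact le_of_eq (by simp [rank, h.1, h.2.1])
    · exact h.le

lemma sameMain_of_rank_eq {i : Fin n} (hi : i ∉ F) {k k' : ℕ} (h : k ≤ k')
    (hr : (localAt t F prop A c k i).rank = (localAt t F prop A c k' i).rank) :
    SameMain (localAt t F prop A c k i) (localAt t F prop A c k' i) := by
  induction k', h using Nat.le_induction with
  | base => exact SameMain.refl _
  | succ k' hk ih =>
    have h1 : (localAt t F prop A c k i).rank ≤ (localAt t F prop A c k' i).rank :=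
      rank_mono hi hk
    rcases (localAt_step (A := A) (c := c) (F := F) (prop := prop) (t := t) k'
      i).sameMain_or_rank_lt (localAt_inv hi k').idle_iff.1 with h | h
    · refine (ih ?_).trans h
      rw [hr]; simp [rank, h.1, h.2.1]
    · omega

/-- A process waits for the coin of a round during one uninterrupted stay, so its view of that round
does not depend on when it is read. -/
lemma view_eq_of_waitCoin {i : Fin n} (hi : i ∉ F) {k k' : ℕ}
    (h1 : (localAt t F prop A c k i).pc = .waitCoin)
    (h2 : (localAt t F prop A c k' i).pc = .waitCoin)
    (h : (localAt t F prop A c k i).round = (localAt t F prop A c k' i).round) :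
    (localAt t F prop A c k i).view = (localAt t F prop A c k' i).view := by
  have hr : (localAt t F prop A c k i).rank = (localAt t F prop A c k' i).rank := by
    simp [rank, h1, h2, h]
  rcases le_total k k' with hk | hk
  · exact (sameMain_of_rank_eq hi hk hr).2.2.2.2.1.symm
  · exact (sameMain_of_rank_eq hi hk hr.symm).2.2.2.2.1

/-- A process in round `r + 1` has completed round `r`. -/
lemma exists_endRound {i : Fin n} {r : ℕ} (hr : 1 ≤ r) {k : ℕ}
    (h : (localAt t F prop A c k i).round = r + 1) :
    ∃ k' < k, (localAt t F prop A c k' i).round = r ∧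
      (localAt t F prop A c k' i).pc = .waitCoin ∧
      localAt t F prop A c (k' + 1) i = (localAt t F prop A c k' i).coinReturn t (c r) ∧
      (localAt t F prop A c k i).s = c r ∧
      (localAt t F prop A c k i).support = nextSupport (localAt t F prop A c k' i).view (c r) := by
  induction k with
  | zero => simp [localAt_zero, LState.init] at h
  | succ k ih =>
    rcases (localAt_step k i).round_cases with ⟨h1, h2, h3⟩ | ⟨-, h1⟩ | ⟨hpc, b, hb, h1⟩
    · obtain ⟨k', hk, h4, h5, h6, h7, h8⟩ := ih (h1 ▸ h)
      exact ⟨k', hk.trans (Nat.lt_succ_self k), h4, h5, h6, h2.trans h7, h3.trans h8⟩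
    · omega
    · have hf := coinReturn_fields t (localAt t F prop A c k i) b
      rw [h1, hf.2.1] at h
      have hrk : (localAt t F prop A c k i).round = r := by omega
      have hbc := (run_globalInv k).coin_some hb
      rw [hrk] at hbc
      subst hbc
      refine ⟨k, Nat.lt_succ_self k, hrk, hpc, h1, ?_, ?_⟩
      · rw [h1, hf.2.2.1]
      · rw [h1, hf.2.2.2.1]

lemma exists_round_of_aux_sent {i : Fin n} {r : ℕ} {w : Bool} {k : ℕ}
    (h : Msg.aux r w ∈ (localAt t F prop A c k i).sent) :
    ∃ k', (localAt t F prop A c k' i).round = r ∧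
      Msg.aux r w ∈ (localAt t F prop A c k' i).sent := by
  induction k with
  | zero => simp [localAt_zero, LState.init] at h
  | succ k ih =>
    rcases (localAt_step k i).aux_sent_cases h with h' | h'
    · exact ih h'
    · exact ⟨k + 1, h', h⟩

lemma exists_of_decision {i : Fin n} {r : ℕ} {v : Bool} {k : ℕ}
    (h : (localAt t F prop A c k i).decision = some (r, v)) :
    v = c r ∧ ∃ k', (localAt t F prop A c k' i).pc = .waitCoin ∧
      (localAt t F prop A c k' i).round = r ∧ (localAt t F prop A c k' i).view = {v} := by
  induction k with
  | zero => simp [localAt_zero, LState.init] at h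
  | succ k ih =>
    rcases (localAt_step k i).decision_cases h with h' | ⟨h1, h2, h3, h4⟩
    · exact ih h'
    · exact ⟨(run_globalInv k).coin_some h4, k, h1, h2, h3⟩

/-- A selection of AUX messages contains one from each set of `t + 1` processes. -/
lemma exists_view_of_card (ht : 3 * t < n) {i : Fin n} (hi : i ∉ F) {k r : ℕ}
    (hpc : (localAt t F prop A c k i).pc = .waitCoin)
    (hr : (localAt t F prop A c k i).round = r)
    {T : Finset (Fin n)} (hT : t + 1 ≤ T.card) (hTF : ∀ j ∈ T, j ∉ F) :
    ∃ j ∈ T, ∃ w ∈ (localAt t F prop A c k i).view,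
      Msg.aux r w ∈ (localAt t F prop A c k j).sent := by
  obtain ⟨f, hf, hv⟩ := (localAt_inv hi k).coin_view hpc
  obtain ⟨j, hj, hjT⟩ := exists_mem_of_card hf.1 hT (by omega)
  obtain ⟨w, hw⟩ := Option.ne_none_iff_exists'.1 (Finset.mem_filter.1 hj).2
  refine ⟨j, hjT, w, (hv w).2 ⟨j, hw⟩, ?_⟩
  rw [← hr]
  exact (run_globalInv k).recv i hi j (hTF j hjT) _ (hf.2 j w hw).1

lemma view_inter (ht : 3 * t < n) (hF : F.card ≤ t) {i i' : Fin n} (hi : i ∉ F) (hi' : i' ∉ F)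
    {k k' r : ℕ} (hpc : (localAt t F prop A c k i).pc = .waitCoin)
    (hr : (localAt t F prop A c k i).round = r)
    (hpc' : (localAt t F prop A c k' i').pc = .waitCoin)
    (hr' : (localAt t F prop A c k' i').round = r) :
    ∃ w ∈ (localAt t F prop A c k i).view, w ∈ (localAt t F prop A c k' i').view := by
  obtain ⟨f, hf, hv⟩ := (localAt_inv hi k).coin_view hpc
  obtain ⟨f', hf', hv'⟩ := (localAt_inv hi' k').coin_view hpc'
  obtain ⟨j, hj, hj', hjF⟩ := exists_mem_inter_notMem ht hF hf.1 hf'.1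
  obtain ⟨w, hw⟩ := Option.ne_none_iff_exists'.1 (Finset.mem_filter.1 hj).2
  obtain ⟨w', hw'⟩ := Option.ne_none_iff_exists'.1 (Finset.mem_filter.1 hj').2
  have h1 := (run_globalInv k).recv i hi j hjF _ (hf.2 j w hw).1
  have h2 := (run_globalInv k').recv i' hi' j hjF _ (hf'.2 j w' hw').1
  change Msg.aux (localAt t F prop A c k i).round w ∈ (localAt t F prop A c k j).sent at h1
  change Msg.aux (localAt t F prop A c k' i').round w' ∈ (localAt t F prop A c k' j).sent at h2
  rw [hr] at h1
  rw [hr'] at h2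
  -- The views may be taken at different times; both messages are in the sender's log at the later
  -- one.
  have h3 := (localAt_inv hjF (max k k')).aux_unique r w w' (sent_mono (le_max_left _ _) h1)
    (sent_mono (le_max_right _ _) h2)
  subst h3
  exact ⟨w, (hv w).2 ⟨j, hw⟩, (hv' w).2 ⟨j, hw'⟩⟩

lemma view_nonempty (ht : 3 * t < n) (hF : F.card ≤ t) {i : Fin n} (hi : i ∉ F) {k : ℕ}
    (hpc : (localAt t F prop A c k i).pc = .waitCoin) :
    (localAt t F prop A c k i).view.Nonempty :=
  have ⟨w, hw, _⟩ := view_inter ht hF hi hi hpc rfl hpc rfl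
  ⟨w, hw⟩

/-- A value that no non-faulty process broadcasts on its own account is never broadcast by a
non-faulty process. -/
lemma sval_notMem_sent (hF : F.card ≤ t) {r : ℕ} {v : Bool}
    (h : ∀ k, ∀ j ∉ F, (localAt t F prop A c k j).round = r →
      (localAt t F prop A c k j).s = !v → (localAt t F prop A c k j).support = true) (k : ℕ) :
    ∀ j ∉ F, Msg.sval r v ∉ (localAt t F prop A c k j).sent := by
  induction k with
  | zero => intro j _; simp [localAt_zero, LState.init]
  | succ k ih =>
    intro j hj hm
    rcases (localAt_step k j).sval_sent_cases hm with h' | h' | ⟨h1, h2, h3⟩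
    · exact ih j hj h'
    -- An echo needs `t + 1` senders, more than `F` has. A message received by time `k + 1` from a
    -- non-faulty process was broadcast by time `k`, which the induction hypothesis excludes.
    · have h1 : (localAt t F prop A c (k + 1) j).senders (.sval r v) ⊆ F := by
        intro i hi
        by_contra hiF
        rw [mem_senders] at hi
        rcases (localAt_step k j).recv_cases i _ hi with h' | h' | h'
        · exact ih i hiF ((run_globalInv k).recv j hj i hiF _ h')
        · exact hiF h'
        · exact ih i hiF h'
      have := Finset.card_le_card h1
      omega
    · simp [h (k + 1) j hj h1 h2] at h3

lemma not_svalue (hF : F.card ≤ t) {r : ℕ} {v : Bool}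
    (h : ∀ k, ∀ j ∉ F, Msg.sval r v ∉ (localAt t F prop A c k j).sent) {i : Fin n} (hi : i ∉ F)
    (k : ℕ) : ¬ (localAt t F prop A c k i).svalue t r v := by
  intro hs
  have h1 : (localAt t F prop A c k i).senders (.sval r v) ⊆ F := by
    intro j hj
    by_contra hjF
    rw [mem_senders] at hj
    exact h k j hjF ((run_globalInv k).recv i hi j hjF _ hj)
  have := Finset.card_le_card h1
  have := hs.2
  omega

/-! ### Locked values, agreement and validity. -/

variable (t F prop A c) in
/-- From round `r` on, only the value `v` can get support: no non-faulty process ever broadcasts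
for the instance to which `binptr[¬v]` points in round `r`. -/
def Locked (r : ℕ) (v : Bool) : Prop :=
  ∀ k, ∀ j ∉ F, Msg.sval (lastPtr c r (!v)) (!v) ∉ (localAt t F prop A c k j).sent

namespace Locked

variable {r : ℕ} {v : Bool}

/-- Values in a view need a true pointer, and the faulty processes alone cannot supply `2t + 1`
messages for `¬v`. -/
lemma view_eq (ht : 3 * t < n) (hF : F.card ≤ t) (h : Locked t F prop A c r v) (hr : 1 ≤ r)
    {i : Fin n} (hi : i ∉ F) {k : ℕ} (hpc : (localAt t F prop A c k i).pc = .waitCoin)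
    (hri : (localAt t F prop A c k i).round = r) : (localAt t F prop A c k i).view = {v} := by
  refine mem_of_ne_not_mem (view_nonempty ht hF hi hpc) fun hv => ?_
  have hb := (localAt_inv hi k).view_binptr hpc hv
  rw [binptr, (localAt_inv hi k).ptr_eq (by omega), hri] at hb
  exact not_svalue hF h hi k hb

/-- The coin lies in every view, so all processes start round `r + 1` with support, and nobody
starts a broadcast in the instance to which the pointer for `¬c r` now leads. -/
lemma of_mem (hF : F.card ≤ t) (hr : 1 ≤ r)
    (h : ∀ i ∉ F, ∀ k, (localAt t F prop A c k i).pc = .waitCoin →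
      (localAt t F prop A c k i).round = r → c r ∈ (localAt t F prop A c k i).view) :
    Locked t F prop A c (r + 1) (c r) := by
  rw [Locked, lastPtr_succ_not]
  apply sval_notMem_sent hF
  intro k j hj hjr _
  obtain ⟨k', -, h1, h2, -, -, h3⟩ := exists_endRound hr hjr
  rw [h3]
  exact nextSupport_of_mem (h j hj k' h2 h1)

/-- If the coin is `v`, all views are `{v}` and the lock arises anew on the fresh instance. If it is
`¬v`, the pointer for `¬v` is kept, and nobody has broadcast for that instance. -/
lemma succ (ht : 3 * t < n) (hF : F.card ≤ t) (h : Locked t F prop A c r v) (hr : 1 ≤ r) :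
    Locked t F prop A c (r + 1) v := by
  by_cases hc : c r = v
  · rw [← hc]
    refine of_mem hF hr fun i hi k h1 h2 => ?_
    rw [h.view_eq ht hF hr hi h1 h2, hc]
    simp
  · have : c r = !v := Bool.eq_not_of_ne hc
    have h1 := lastPtr_succ_self c hr
    rw [this] at h1
    rw [Locked, h1]
    exact h

lemma of_le (ht : 3 * t < n) (hF : F.card ≤ t) (h : Locked t F prop A c r v) (hr : 1 ≤ r)
    {r' : ℕ} (hr' : r ≤ r') : Locked t F prop A c r' v := by
  induction r', hr' using Nat.le_induction with
  | base => exact h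
  | succ k hk ih => exact ih.succ ht hF (hr.trans hk)

end Locked

/-- If a process has the view `{c r}` in round `r`, then `c r` is locked. -/
lemma locked_of_view (ht : 3 * t < n) (hF : F.card ≤ t) {i : Fin n} (hi : i ∉ F) {k r : ℕ}
    (hpc : (localAt t F prop A c k i).pc = .waitCoin)
    (hr : (localAt t F prop A c k i).round = r)
    (hv : (localAt t F prop A c k i).view = {c r}) : Locked t F prop A c (r + 1) (c r) := by
  have h1 : 1 ≤ r := hr ▸ (localAt_inv hi k).one_le_round (by simp [hpc])
  refine Locked.of_mem hF h1 fun j hj k' h2 h3 => ?_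
  obtain ⟨w, hw, hw'⟩ := view_inter ht hF hi hj hpc hr h2 h3
  rw [hv, Finset.mem_singleton] at hw
  exact hw ▸ hw'

lemma decides_eq_coin {i : Fin n} {r : ℕ} {v : Bool} (h : Decides t F prop A c i r v) :
    v = c r :=
  have ⟨_, hk⟩ := h
  (exists_of_decision hk).1

lemma agreement_of_le (ht : 3 * t < n) (hF : F.card ≤ t) {i j : Fin n} (hi : i ∉ F) (hj : j ∉ F)
    {r r' : ℕ} {v v' : Bool} (h : Decides t F prop A c i r v) (h' : Decides t F prop A c j r' v')
    (hr : r ≤ r') : v = v' := by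
  rcases hr.eq_or_lt with rfl | hr
  · rw [decides_eq_coin h, decides_eq_coin h']
  · obtain ⟨k, hk⟩ := h
    obtain ⟨k', hk'⟩ := h'
    obtain ⟨h1, l, h2, h3, h4⟩ := exists_of_decision hk
    obtain ⟨-, l', h2', h3', h4'⟩ := exists_of_decision hk'
    -- The earlier decision locks its value from the following round on, which includes the later
    -- deciding round.
    have := (locked_of_view ht hF hi h2 h3 (h1 ▸ h4)).of_le ht hF (by omega) hr
    have := this.view_eq ht hF (by omega) hj h2' h3'
    rw [h4', Finset.singleton_inj] at this
    rw [this, h1]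

theorem agreement (ht : 3 * t < n) (hF : F.card ≤ t) {i j : Fin n} (hi : i ∉ F) (hj : j ∉ F)
    {r r' : ℕ} {v v' : Bool} (h : Decides t F prop A c i r v)
    (h' : Decides t F prop A c j r' v') : v = v' := by
  rcases le_total r r' with hr | hr
  · exact agreement_of_le ht hF hi hj h h' hr
  · exact (agreement_of_le ht hF hj hi h' h hr).symm

theorem validity (ht : 3 * t < n) (hF : F.card ≤ t) {u : Bool} (hu : ∀ i ∉ F, prop i = u)
    {i : Fin n} (hi : i ∉ F) {r : ℕ} {v : Bool} (h : Decides t F prop A c i r v) : v = u := by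
  -- In round 1, `s` is the negated proposal, so starting a broadcast of `¬u` would require
  -- proposing `¬u`.
  have hl : Locked t F prop A c 1 u := by
    have : lastPtr c 1 (!u) = 1 := by simp [lastPtr]
    rw [Locked, this]
    apply sval_notMem_sent hF
    intro k j hj hr hs
    have := ((localAt_inv hj k).first hr).1
    rw [hs, hu j hj] at this
    simp at this
  obtain ⟨k, hk⟩ := h
  obtain ⟨-, l, h2, h3, h4⟩ := exists_of_decision hk
  have h1 : 1 ≤ r := h3 ▸ (localAt_inv hi l).one_le_round (by simp [h2])
  have := (hl.of_le ht hF le_rfl h1).view_eq ht hF h1 hi h2 h3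
  rw [h4, Finset.singleton_inj] at this
  exact this

/-! ### Counting broadcasts. -/

/-- The messages for round `r` that a process has broadcast. -/
def roundMsgs {n : ℕ} (L : LState n) (r : ℕ) : Finset Msg :=
  (L.sent.filter fun m => m.round = r).toFinset

lemma mem_roundMsgs {L : LState n} {r : ℕ} {m : Msg} :
    m ∈ roundMsgs L r ↔ m ∈ L.sent ∧ m.round = r := by
  simp [roundMsgs]

lemma broadcasts_eq_card {i : Fin n} (hi : i ∉ F) (k r : ℕ) :
    broadcasts t F prop A c k i r = (roundMsgs (localAt t F prop A c k i) r).card := by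
  rw [roundMsgs, List.toFinset_card_of_nodup ((localAt_inv hi k).nodup.filter _),
    ← List.countP_eq_length_filter, broadcasts]

lemma exists_aux_eq {p : Bool} {L : LState n} (h : LocalInv t c p L) (r : ℕ) :
    ∃ w, ∀ w', Msg.aux r w' ∈ L.sent → w' = w := by
  by_cases hw : ∃ w, Msg.aux r w ∈ L.sent
  · obtain ⟨w, hw⟩ := hw
    exact ⟨w, fun w' hw' => h.aux_unique r w' w hw' hw⟩
  · push Not at hw
    exact ⟨false, fun w' hw' => absurd hw' (hw w')⟩

theorem broadcasts_first {i : Fin n} (hi : i ∉ F) (k : ℕ) :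
    broadcasts t F prop A c k i 1 ≤ 3 ∧
      (1 < (localAt t F prop A c k i).round → 2 ≤ broadcasts t F prop A c k i 1) := by
  rw [broadcasts_eq_card hi]
  have hL := localAt_inv (t := t) (prop := prop) (A := A) (c := c) hi k
  constructor
  · obtain ⟨w, hw⟩ := exists_aux_eq hL 1
    have : roundMsgs (localAt t F prop A c k i) 1 ⊆
        {.sval 1 false, .sval 1 true, .aux 1 w} := by
      intro m hm
      obtain ⟨h1, h2⟩ := mem_roundMsgs.1 hm
      cases m with
      | sval r v => cases h2; cases v <;> simp
      | aux r v => cases h2; simp at h1 ⊢; exact hw v h1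
    exact (Finset.card_le_card this).trans Finset.card_le_three
  · intro hr
    obtain ⟨w, hw⟩ := hL.aux_exists 1 le_rfl (Or.inl hr)
    have : ({.sval 1 (prop i), .aux 1 w} : Finset Msg) ⊆
        roundMsgs (localAt t F prop A c k i) 1 := by
      intro m hm
      rw [mem_roundMsgs]
      simp only [Finset.mem_insert, Finset.mem_singleton] at hm
      rcases hm with rfl | rfl
      · exact ⟨hL.sval_proposal hr.le, rfl⟩
      · exact ⟨hw, rfl⟩
    refine le_trans ?_ (Finset.card_le_card this)
    rw [Finset.card_pair (by simp)]

/-- From round 2 on, only the instance for `¬c (r - 1)` is invoked, so one SVAL and one AUX are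
possible; the AUX is certain in a completed round. -/
theorem broadcasts_later {i : Fin n} (hi : i ∉ F) (k : ℕ) {r : ℕ} (hr : 2 ≤ r) :
    broadcasts t F prop A c k i r ≤ 2 ∧
      (r < (localAt t F prop A c k i).round → 1 ≤ broadcasts t F prop A c k i r) := by
  rw [broadcasts_eq_card hi]
  have hL := localAt_inv (t := t) (prop := prop) (A := A) (c := c) hi k
  constructor
  · obtain ⟨w, hw⟩ := exists_aux_eq hL r
    have : roundMsgs (localAt t F prop A c k i) r ⊆ {.sval r (!c (r - 1)), .aux r w} := by
      intro m hm
      obtain ⟨h1, h2⟩ := mem_roundMsgs.1 hm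
      cases m with
      | sval r' v =>
        cases h2
        simp only [Msg.round] at hr h1 ⊢
        have := ((hL.called_iff _ _).1 (hL.sval_called _ _ h1)).2.2
        simp [this.resolve_left (by omega)]
      | aux r' v => cases h2; simp [Msg.round] at h1 ⊢; exact hw v h1
    exact (Finset.card_le_card this).trans Finset.card_le_two
  · intro hr'
    obtain ⟨w, hw⟩ := hL.aux_exists r (by omega) (Or.inl hr')
    exact Finset.card_pos.2 ⟨_, mem_roundMsgs.2 ⟨hw, rfl⟩⟩

end Runs

open LState Filter

/-! ### Liveness: every non-faulty process reaches every round. -/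

section Liveness

variable {n t : ℕ} {F : Finset (Fin n)} {prop : Fin n → Bool} {A : Adversary n} {c : ℕ → Bool}

lemma LState.le_round_iff {L : LState n} {r : ℕ} : r ≤ L.round ↔ 4 * r ≤ L.rank := by
  unfold rank; split <;> omega

lemma LState.pastPtr_iff {L : LState n} {r : ℕ} : L.PastPtr r ↔ 4 * r < L.rank := by
  unfold rank PastPtr; split <;> simp_all <;> omega

lemma LState.pastAux_iff {L : LState n} {r : ℕ} : L.PastAux r ↔ 4 * r + 1 < L.rank := by
  unfold rank PastAux; split <;> simp_all <;> omega

lemma card_compl_ge (ht : 3 * t < n) (hF : F.card ≤ t) :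
    2 * t + 1 ≤ Fᶜ.card ∧ n - t ≤ Fᶜ.card := by
  rw [Finset.card_compl, Fintype.card_fin]; omega

lemma eventually_le_rank {i : Fin n} (hi : i ∉ F) {m k : ℕ}
    (h : m ≤ (localAt t F prop A c k i).rank) :
    ∀ᶠ k in atTop, m ≤ (localAt t F prop A c k i).rank :=
  eventually_atTop.2 ⟨k, fun _ hk => h.trans (rank_mono hi hk)⟩

/-- Progress of the main thread of a process that is eventually ready. -/
lemma exists_lt_rank (hA : Admissible t F prop A c) {i : Fin n} (hi : i ∉ F) {m : ℕ}
    (h1 : ∀ᶠ k in atTop, m ≤ (localAt t F prop A c k i).rank)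
    (h2 : ∀ᶠ k in atTop, (localAt t F prop A c k i).rank = m →
      (run t F prop A c k).2.Ready t i) :
    ∀ᶠ k in atTop, m < (localAt t F prop A c k i).rank := by
  by_contra hcon
  -- By monotonicity a rank that ever exceeds `m` does so for good. Otherwise it stays at `m`, which
  -- freezes `pc`, contrary to readiness.
  have hle : ∀ k, (localAt t F prop A c k i).rank ≤ m := by
    intro k
    by_contra hk
    exact hcon (eventually_le_rank hi (not_le.1 hk))
  obtain ⟨k, hk1, hk2⟩ := (h1.and h2).exists
  obtain ⟨k', hk', hpc⟩ := hA.2 i hi k (hk2 (le_antisymm (hle k) hk1))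
  have h3 : (localAt t F prop A c k i).rank ≤ (localAt t F prop A c k' i).rank :=
    rank_mono hi hk'
  have h4 := hle k'
  exact hpc (sameMain_of_rank_eq hi hk' (by omega)).1

lemma eventually_received (hA : Admissible t F prop A c) {i : Fin n} (hi : i ∉ F)
    {T : Finset (Fin n)} (hT : ∀ j ∈ T, j ∉ F) {m : Fin n → Msg}
    (h : ∀ j ∈ T, ∃ k, m j ∈ (localAt t F prop A c k j).sent) :
    ∀ᶠ k in atTop, ∀ j ∈ T, (j, m j) ∈ (localAt t F prop A c k i).recv := by
  rw [eventually_all_finset]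
  intro j hj
  obtain ⟨k, hk⟩ := h j hj
  obtain ⟨k', hk'⟩ := hA.1 j (hT j hj) i hi k _ hk
  exact eventually_atTop.2 ⟨k', fun l hl => recv_mono i hl hk'⟩

lemma eventually_card_senders (hA : Admissible t F prop A c) {i : Fin n} (hi : i ∉ F)
    {T : Finset (Fin n)} (hT : ∀ j ∈ T, j ∉ F) {m : Msg}
    (h : ∀ j ∈ T, ∃ k, m ∈ (localAt t F prop A c k j).sent) :
    ∀ᶠ k in atTop, T.card ≤ ((localAt t F prop A c k i).senders m).card := by
  filter_upwards [eventually_received hA hi hT h] with k hk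
  exact Finset.card_le_card fun j hj => mem_senders.2 (hk j hj)

/-- If `t + 1` non-faulty processes broadcast for an instance of S-Broadcast that all non-faulty
processes invoke, then its Boolean becomes true everywhere. -/
lemma eventually_svalue (ht : 3 * t < n) (hF : F.card ≤ t) (hA : Admissible t F prop A c)
    {r : ℕ} {v : Bool}
    (hcalled : ∀ i ∉ F, ∀ᶠ k in atTop, (r, v) ∈ (localAt t F prop A c k i).called)
    {T : Finset (Fin n)} (hT : ∀ j ∈ T, j ∉ F) (hTc : t + 1 ≤ T.card)
    (h : ∀ j ∈ T, ∃ k, Msg.sval r v ∈ (localAt t F prop A c k j).sent) {i : Fin n} (hi : i ∉ F) :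
    ∀ᶠ k in atTop, (localAt t F prop A c k i).svalue t r v := by
  -- The `t + 1` broadcasts make every non-faulty process echo, which gives the `2t + 1` messages
  -- needed.
  have h1 : ∀ j ∈ Fᶜ, ∃ k, Msg.sval r v ∈ (localAt t F prop A c k j).sent := by
    intro j hj
    rw [Finset.mem_compl] at hj
    obtain ⟨k, hk1, hk2⟩ := ((hcalled j hj).and (eventually_card_senders hA hj hT h)).exists
    exact ⟨k, (localAt_inv hj k).echo_sent r v hk1 (hTc.trans hk2)⟩
  filter_upwards [hcalled i hi,
    eventually_card_senders hA hi (fun j hj => Finset.mem_compl.1 hj) h1] with k hk1 hk2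
  exact ⟨hk1, (card_compl_ge ht hF).1.trans hk2⟩

/-- Among the `2t + 1` senders seen by `j`, at least `t + 1` are non-faulty, and their broadcasts
reach everybody. -/
lemma eventually_svalue_of_svalue (ht : 3 * t < n) (hF : F.card ≤ t)
    (hA : Admissible t F prop A c) {r : ℕ} {v : Bool}
    (hcalled : ∀ i ∉ F, ∀ᶠ k in atTop, (r, v) ∈ (localAt t F prop A c k i).called)
    {j : Fin n} (hj : j ∉ F) {k : ℕ} (h : (localAt t F prop A c k j).svalue t r v)
    {i : Fin n} (hi : i ∉ F) :
    ∀ᶠ k in atTop, (localAt t F prop A c k i).svalue t r v := by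
  refine eventually_svalue ht hF hA hcalled
    (T := (localAt t F prop A c k j).senders (.sval r v) \ F) (by simp) ?_ ?_ hi
  · have := Finset.le_card_sdiff F ((localAt t F prop A c k j).senders (.sval r v))
    have := h.2
    omega
  · intro l hl
    rw [Finset.mem_sdiff, mem_senders] at hl
    exact ⟨k, (run_globalInv k).recv j hj l hl.2 _ hl.1⟩

lemma eventually_called {r : ℕ} (hr : 1 ≤ r)
    (hR : ∀ i ∉ F, ∀ᶠ k in atTop, r ≤ (localAt t F prop A c k i).round) (v : Bool) :
    ∀ i ∉ F, ∀ᶠ k in atTop, (lastPtr c r v, v) ∈ (localAt t F prop A c k i).called := by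
  intro i hi
  filter_upwards [hR i hi] with k hk
  exact ((localAt_inv hi k).called_iff _ _).2 ⟨(lastPtr_le c r v).trans hk, invoked_lastPtr c hr v⟩

lemma exists_round_eq {i : Fin n} {r : ℕ} (hr : 1 ≤ r) {k : ℕ}
    (h : r ≤ (localAt t F prop A c k i).round) : ∃ k', (localAt t F prop A c k' i).round = r := by
  induction k with
  | zero => simp [localAt_zero, LState.init] at h; omega
  | succ k ih =>
    rcases h.eq_or_lt with h' | h'
    · exact ⟨k + 1, h'.symm⟩
    · rcases (localAt_step k i).round_cases with ⟨h1, -⟩ | ⟨-, h1⟩ | ⟨-, b, -, h1⟩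
      · exact ih (h1 ▸ h)
      · omega
      · rw [h1, (coinReturn_fields _ _ _).2.1] at h'
        exact ih (by omega)

/-- In each round that all non-faulty processes reach, the wait for a true `binptr` ends. -/
lemma exists_eventually_svalue (ht : 3 * t < n) (hF : F.card ≤ t) (hA : Admissible t F prop A c)
    {r : ℕ} (hr : 1 ≤ r)
    (hR : ∀ i ∉ F, ∀ᶠ k in atTop, r ≤ (localAt t F prop A c k i).round) :
    ∃ v, ∀ i ∉ F, ∀ᶠ k in atTop, (localAt t F prop A c k i).svalue t (lastPtr c r v) v := by
  by_cases hs : ∃ i ∉ F, ∃ k, (localAt t F prop A c k i).round = r ∧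
      (localAt t F prop A c k i).support = true
  · obtain ⟨i, hi, k, h1, h2⟩ := hs
    refine ⟨(localAt t F prop A c k i).s, fun j hj => ?_⟩
    have h3 := (localAt_inv hi k).support_ptr h2
    rw [binptr, (localAt_inv hi k).ptr_eq (by omega), h1] at h3
    exact eventually_svalue_of_svalue ht hF hA (eventually_called hr hR _) hi h3 hj
  · push Not at hs
    have hsent : ∀ i ∉ F, ∃ k, (localAt t F prop A c k i).round = r ∧
        Msg.sval r (!(localAt t F prop A c k i).s) ∈ (localAt t F prop A c k i).sent := by
      intro i hi
      obtain ⟨k, hk⟩ := (hR i hi).exists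
      obtain ⟨k', hk'⟩ := exists_round_eq hr hk
      have := (localAt_inv hi k').sval_noSupport (hr.trans_eq hk'.symm)
        (by simpa using hs i hi k' hk')
      rw [hk'] at this
      exact ⟨k', hk', this⟩
    rcases hr.eq_or_lt with rfl | hr'
    -- In round 1 the own values are the proposals; among at least `2t + 1` of them one value occurs
    -- `t + 1` times.
    · have hp : ∃ v, t + 1 ≤ (Fᶜ.filter fun i => prop i = v).card := by
        by_contra! h
        have h1 := h true
        have h2 := h false
        have h3 := Finset.card_filter_add_card_filter_not (s := Fᶜ) (fun i => prop i = true)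
        simp only [Bool.not_eq_true] at h3
        have := (card_compl_ge ht hF).1
        omega
      obtain ⟨v, hv⟩ := hp
      refine ⟨v, fun i hi => eventually_svalue ht hF hA (eventually_called hr hR _)
        (T := Fᶜ.filter fun i => prop i = v) ?_ hv ?_ hi⟩
      · simp +contextual
      · intro j hj
        simp only [Finset.mem_filter, Finset.mem_compl] at hj
        obtain ⟨k, hk, hk'⟩ := hsent j hj.1
        rw [((localAt_inv hj.1 k).first hk).1, hj.2, Bool.not_not] at hk'
        exact ⟨k, by simpa [lastPtr] using hk'⟩
    -- Later, all non-faulty processes hold the same coin and, being without support, all broadcast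
    -- its negation.
    · refine ⟨!c (r - 1), fun i hi => eventually_svalue ht hF hA (eventually_called hr hR _)
        (T := Fᶜ) (by simp) ((card_compl_ge ht hF).1.trans' (by omega)) ?_ hi⟩
      intro j hj
      rw [Finset.mem_compl] at hj
      obtain ⟨k, hk, hk'⟩ := hsent j hj
      rw [(localAt_inv hj k).s_coin (by omega), hk] at hk'
      refine ⟨k, ?_⟩
      have := lastPtr_succ_not c (r - 1)
      rw [Nat.sub_add_cancel hr] at this
      rwa [this]

lemma eventually_pastPtr (ht : 3 * t < n) (hF : F.card ≤ t) (hA : Admissible t F prop A c)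
    {r : ℕ} (hr : 1 ≤ r)
    (hR : ∀ i ∉ F, ∀ᶠ k in atTop, r ≤ (localAt t F prop A c k i).round) {i : Fin n} (hi : i ∉ F) :
    ∀ᶠ k in atTop, (localAt t F prop A c k i).PastPtr r := by
  obtain ⟨v, hv⟩ := exists_eventually_svalue ht hF hA hr hR
  simp only [pastPtr_iff]
  refine exists_lt_rank hA hi (by simpa only [le_round_iff] using hR i hi) ?_
  filter_upwards [hv i hi, hR i hi] with k hk hk' hrank
  have hL := localAt_inv (t := t) (prop := prop) (A := A) (c := c) hi k
  have h1 : (localAt t F prop A c k i).pc = .waitPtr ∧ (localAt t F prop A c k i).round = r := by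
    have := hL.idle_iff
    revert hrank
    unfold rank
    split <;> intro hrank <;> simp_all <;> omega
  have hb : (localAt t F prop A c k i).binptr t v := by
    rw [binptr, hL.ptr_eq (by omega), h1.2]; exact hk
  have h2 : (localAt t F prop A c k i).ptrReady t := by
    cases v
    · exact Or.inl hb
    · exact Or.inr hb
  unfold Config.Ready
  change match (localAt t F prop A c k i).pc with
    | .idle => True
    | .waitPtr => (localAt t F prop A c k i).ptrReady t
    | .waitAux => _
    | .waitCoin => _
  rw [h1.1]
  exact h2

/-- Each AUX value of a non-faulty process had a true pointer at its sender, hence gets one at `i`;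
so the messages of `n - t` non-faulty processes form a valid quorum. -/
lemma eventually_pastAux (ht : 3 * t < n) (hF : F.card ≤ t) (hA : Admissible t F prop A c)
    {r : ℕ} (hr : 1 ≤ r)
    (hR : ∀ i ∉ F, ∀ᶠ k in atTop, r ≤ (localAt t F prop A c k i).round) {i : Fin n} (hi : i ∉ F) :
    ∀ᶠ k in atTop, (localAt t F prop A c k i).PastAux r := by
  have hw : ∀ j : Fin n, ∃ w : Bool, j ∉ F →
      (∃ k, Msg.aux r w ∈ (localAt t F prop A c k j).sent) ∧
      ∀ᶠ k in atTop, (localAt t F prop A c k i).svalue t (lastPtr c r w) w := by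
    intro j
    by_cases hj : j ∈ F
    · exact ⟨false, fun h => absurd hj h⟩
    · obtain ⟨k, hk⟩ := (eventually_pastPtr ht hF hA hr hR hj).exists
      obtain ⟨w, hw⟩ := (localAt_inv hj k).aux_exists r hr hk
      exact ⟨w, fun _ => ⟨⟨k, hw⟩, eventually_svalue_of_svalue ht hF hA
        (eventually_called hr hR _) hj ((localAt_inv hj k).aux_sent r w hw).2.2 hi⟩⟩
  choose w hw using hw
  obtain ⟨S, hSF, hS⟩ := Finset.exists_subset_card_eq (card_compl_ge ht hF).2
  have hSF' : ∀ j ∈ S, j ∉ F := fun j hj => Finset.mem_compl.1 (hSF hj)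
  have h1 := eventually_received hA hi hSF' (m := fun j => .aux r (w j))
    fun j hj => (hw j (hSF' j hj)).1
  have h2 : ∀ᶠ k in atTop, ∀ j ∈ S,
      (localAt t F prop A c k i).svalue t (lastPtr c r (w j)) (w j) := by
    rw [eventually_all_finset]
    exact fun j hj => (hw j (hSF' j hj)).2
  have h3 := eventually_pastPtr ht hF hA hr hR hi
  simp only [pastPtr_iff] at h3
  simp only [pastAux_iff]
  refine exists_lt_rank hA hi h3 ?_
  filter_upwards [h1, h2, hR i hi] with k hk1 hk2 hk' hrank
  have hL := localAt_inv (t := t) (prop := prop) (A := A) (c := c) hi k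
  have h1 : (localAt t F prop A c k i).pc = .waitAux ∧ (localAt t F prop A c k i).round = r := by
    revert hrank
    unfold rank
    split <;> intro hrank <;> simp_all <;> omega
  have hq : (localAt t F prop A c k i).AuxQuorum t fun j => if j ∈ S then some (w j) else none := by
    refine ⟨by simpa using hS, fun j v hj => ?_⟩
    simp only [Option.ite_none_right_eq_some, Option.some.injEq] at hj
    obtain ⟨hj, rfl⟩ := hj
    rw [binptr, hL.ptr_eq (by omega), h1.2]
    exact ⟨hk1 j hj, hk2 j hj⟩
  unfold Config.Ready
  change match (localAt t F prop A c k i).pc with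
    | .idle => True
    | .waitPtr => _
    | .waitAux => ∃ f, (localAt t F prop A c k i).AuxQuorum t f
    | .waitCoin => _
  rw [h1.1]
  exact ⟨_, hq⟩

/-- Every non-faulty process reaches every round. -/
theorem eventually_le_round (ht : 3 * t < n) (hF : F.card ≤ t) (hA : Admissible t F prop A c)
    (r : ℕ) : ∀ i ∉ F, ∀ᶠ k in atTop, r ≤ (localAt t F prop A c k i).round := by
  induction r with
  | zero => simp
  | succ r ih =>
    intro i hi
    rcases Nat.eq_zero_or_pos r with rfl | hr
    · have : ∀ᶠ k in atTop, 0 < (localAt t F prop A c k i).rank := by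
        refine exists_lt_rank hA hi (by simp) (Eventually.of_forall fun k hk => ?_)
        have hpc : (localAt t F prop A c k i).pc = .idle := by
          rw [(localAt_inv hi k).idle_iff]; unfold rank at hk; omega
        unfold Config.Ready
        change match (localAt t F prop A c k i).pc with
          | .idle => True
          | .waitPtr => _
          | .waitAux => _
          | .waitCoin => _
        rw [hpc]
        trivial
      filter_upwards [this] with k hk
      have := (localAt_inv (t := t) (prop := prop) (A := A) (c := c) hi k).idle_iff
      by_contra h0
      have h0 : (localAt t F prop A c k i).round = 0 := by omega
      simp [rank, this.2 h0, h0] at hk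
    · have h1 : ∀ᶠ k in atTop, ∀ j ∈ Fᶜ, (localAt t F prop A c k j).PastAux r := by
        rw [eventually_all_finset]
        exact fun j hj => eventually_pastAux ht hF hA hr ih (Finset.mem_compl.1 hj)
      have h2 := eventually_pastAux ht hF hA hr ih hi
      simp only [pastAux_iff] at h2
      have h3 : ∀ᶠ k in atTop, 4 * r + 2 < (localAt t F prop A c k i).rank := by
        refine exists_lt_rank hA hi h2 ?_
        filter_upwards [h1] with k hk1 hrank
        have h4 : (localAt t F prop A c k i).pc = .waitCoin ∧
            (localAt t F prop A c k i).round = r := by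
          revert hrank
          unfold rank
          split <;> intro hrank <;> simp_all <;> omega
        have hcoin : (run t F prop A c k).2.coin r ≠ none := by
          rw [(run_globalInv k).coin_eq, if_pos]
          · simp
          refine le_trans ?_ (Finset.card_le_card fun j hj =>
            ((run_globalInv k).asked_iff j r).2 ⟨Finset.mem_compl.1 hj, hr, hk1 j hj⟩)
          exact (card_compl_ge ht hF).1.trans' (by omega)
        unfold Config.Ready
        change match (localAt t F prop A c k i).pc with
          | .idle => True
          | .waitPtr => _
          | .waitAux => _
          | .waitCoin => (run t F prop A c k).2.coin (localAt t F prop A c k i).round ≠ none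
        rw [h4.1, h4.2]
        exact hcoin
      filter_upwards [h3] with k hk
      unfold rank at hk
      split at hk <;> omega

end Liveness

open LState Filter

/-! ### Early values, stages, and dependence on the coins. -/

section Coins

variable {n t : ℕ} {F : Finset (Fin n)} {prop : Fin n → Bool} {A : Adversary n} {c c' : ℕ → Bool}

lemma Config.step_congr {C : Config n} {a : Action n}
    (h : ∀ i f, a = .callCoin i f → i ∉ F → (C.loc i).pc = .waitAux → (C.loc i).AuxQuorum t f →
      t + 1 ≤ (insert i (C.asked (C.loc i).round)).card →
      c (C.loc i).round = c' (C.loc i).round) :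
    C.step t F prop c a = C.step t F prop c' a := by
  cases a with
  | callCoin i f =>
    simp only [Config.step]
    split_ifs with h1
    · simp only [Config.ask]
      split_ifs with h2
      · rw [h i f rfl h1.1 h1.2.1 h1.2.2 h2]
      · rfl
    · rfl
  | _ => rfl

/-- Local states read only coins already stored in `C`. The call that reveals a coin therefore
yields a view independent of it, which lets `EarlyView` look one event further. -/
lemma Config.step_loc_congr (C : Config n) (a : Action n) (c c' : ℕ → Bool) :
    (C.step t F prop c a).loc = (C.step t F prop c' a).loc := by
  cases a with
  | callCoin i f => simp only [Config.step]; split_ifs <;> rfl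
  | _ => rfl

/-- Before the coin of round `r` is revealed, an execution does not depend on the coins of the
rounds from `r` on. -/
lemma run_congr {r : ℕ} (hr : 1 ≤ r) (hc : ∀ r' < r, c r' = c' r') {k : ℕ}
    (h : (run t F prop A c k).2.coin r = none) :
    run t F prop A c' k = run t F prop A c k := by
  induction k with
  | zero => rfl
  | succ k ih =>
    have h0 : (run t F prop A c k).2.coin r = none := by
      by_contra h'
      exact (run_globalInv k).coin_mono _ h' h
    have ih := ih h0
    simp only [run]
    rw [ih]
    congr 1
    -- A coin revealed by this event belongs to a round before `r`: round `r` itself would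
    -- contradict `h`, and a later round would require the coin of round `r` to be out.
    refine (Config.step_congr fun i f ha hi hpc hf hcard => hc _ ?_).symm
    by_contra hlt
    rcases (not_lt.1 hlt).eq_or_lt with h' | h'
    · simp only [run] at h
      rw [ha, Config.step, if_pos ⟨hi, hpc, hf⟩, Config.ask_coin, if_pos] at h
      · simp at h
      · exact ⟨h', hcard⟩
    · exact (run_globalInv k).coin_prev i hi r hr h' h0

/-- Some non-faulty process obtains the view `{v}` in round `r` not later than the call of
`random()` that reveals the coin of that round. -/
def EarlyView (t : ℕ) (F : Finset (Fin n)) (prop : Fin n → Bool) (A : Adversary n)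
    (c : ℕ → Bool) (r : ℕ) (v : Bool) : Prop :=
  ∃ k, ∃ i ∉ F, (run t F prop A c k).2.coin r = none ∧
    (localAt t F prop A c (k + 1) i).pc = .waitCoin ∧
    (localAt t F prop A c (k + 1) i).round = r ∧ (localAt t F prop A c (k + 1) i).view = {v}

lemma EarlyView.congr {r : ℕ} {v : Bool} (hr : 1 ≤ r) (hc : ∀ r' < r, c r' = c' r')
    (h : EarlyView t F prop A c r v) : EarlyView t F prop A c' r v := by
  obtain ⟨k, i, hi, h1, h2⟩ := h
  have hrun := run_congr hr hc h1
  refine ⟨k, i, hi, hrun ▸ h1, ?_⟩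
  have : localAt t F prop A c' (k + 1) i = localAt t F prop A c (k + 1) i := by
    simp only [localAt, run]
    rw [hrun, Config.step_loc_congr _ _ c' c]
  rwa [this]

open Classical in
/-- A value that is a singleton view of round `r`, determined before the coin of that round is
revealed. -/
noncomputable def earlyValue (t : ℕ) (F : Finset (Fin n)) (prop : Fin n → Bool) (A : Adversary n)
    (c : ℕ → Bool) (r : ℕ) : Option Bool :=
  if EarlyView t F prop A c r false then some false
  else if EarlyView t F prop A c r true then some true else none

lemma earlyValue_congr {r : ℕ} (hr : 1 ≤ r) (hc : ∀ r' < r, c r' = c' r') :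
    earlyValue t F prop A c r = earlyValue t F prop A c' r := by
  have h : EarlyView t F prop A c r = EarlyView t F prop A c' r := funext fun v => propext
    ⟨EarlyView.congr hr hc, EarlyView.congr hr fun r' h => (hc r' h).symm⟩
  rw [earlyValue, earlyValue, h]

lemma earlyView_of_earlyValue {r : ℕ} {v : Bool} (h : earlyValue t F prop A c r = some v) :
    EarlyView t F prop A c r v := by
  unfold earlyValue at h
  split_ifs at h with h1 h2 <;> simp only [Option.some.injEq] at h <;> subst h <;> assumption

lemma not_earlyView_of_earlyValue {r : ℕ} (h : earlyValue t F prop A c r = none) (v : Bool) :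
    ¬ EarlyView t F prop A c r v := by
  unfold earlyValue at h
  split_ifs at h with h1 h2
  cases v <;> assumption

/-- What is known about an execution at the start of a round. -/
inductive Stage where
  | undetermined
  | aligned (v : Bool)
  | locked (v : Bool)
  | decided
  deriving DecidableEq

/-- The next stage, for the early value `g` and the coin `b` of the round. -/
def Stage.next (g : Option Bool) (b : Bool) : Stage → Stage
  | .undetermined =>
    match g with
    | some v => if b = v then .locked v else .undetermined
    | none => .aligned b
  | .aligned v => if b = v then .locked v else .undetermined
  | .locked v => if b = v then .decided else .locked v
  | .decided => .decided

/-- The stage at the start of round `m + 1`. -/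
noncomputable def stage (t : ℕ) (F : Finset (Fin n)) (prop : Fin n → Bool) (A : Adversary n)
    (c : ℕ → Bool) : ℕ → Stage
  | 0 => .undetermined
  | m + 1 => (stage t F prop A c m).next (earlyValue t F prop A c (m + 1)) (c (m + 1))

lemma stage_congr {m : ℕ} (hc : ∀ r < m + 1, c r = c' r) :
    stage t F prop A c m = stage t F prop A c' m := by
  induction m with
  | zero => rfl
  | succ m ih =>
    rw [stage, stage, ih fun r hr => hc r (by omega), hc (m + 1) (by omega),
      earlyValue_congr (by omega) fun r hr => hc r (by omega)]

lemma exists_reveal {r k : ℕ} (h : (run t F prop A c k).2.coin r ≠ none) :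
    ∃ l, (run t F prop A c l).2.coin r = none ∧ (run t F prop A c (l + 1)).2.coin r ≠ none := by
  induction k with
  | zero => exact absurd rfl h
  | succ k ih =>
    by_cases h' : (run t F prop A c k).2.coin r = none
    · exact ⟨k, h', h⟩
    · exact ih h'

/-- If all early views of round `r` are `{0, 1}`, then all views of round `r + 1` contain the coin
of round `r`. -/
lemma mem_view_of_earlyValue_none (ht : 3 * t < n) (hF : F.card ≤ t) {r : ℕ} (hr : 1 ≤ r)
    (h : earlyValue t F prop A c r = none) {i : Fin n} (hi : i ∉ F) {k : ℕ}
    (hpc : (localAt t F prop A c k i).pc = .waitCoin)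
    (hri : (localAt t F prop A c k i).round = r + 1) :
    c r ∈ (localAt t F prop A c k i).view := by
  have hrev : (run t F prop A c k).2.coin r ≠ none :=
    (run_globalInv k).coin_prev i hi r hr (hri ▸ Nat.lt_succ_self r :
      r < (localAt t F prop A c k i).round)
  obtain ⟨l, hl, hl'⟩ := exists_reveal hrev
  have hT : t + 1 ≤ ((run t F prop A c (l + 1)).2.asked r).card := by
    rw [(run_globalInv (l + 1)).coin_eq] at hl'
    by_contra hcon
    rw [if_neg hcon] at hl'
    exact hl' rfl
  have hask := fun j => (run_globalInv (t := t) (F := F) (prop := prop) (A := A) (c := c)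
    (l + 1)).asked_iff j r
  -- The AUX quorum of round `r + 1` meets the `t + 1` callers that revealed the coin of round `r`.
  obtain ⟨j, hjT, w, hw, hjw⟩ :=
    exists_view_of_card ht hi hpc hri hT fun j hj => ((hask j).1 hj).1
  obtain ⟨hj, -, hjp⟩ := (hask j).1 hjT
  change (localAt t F prop A c (l + 1) j).PastAux r at hjp
  -- The coin was hidden until the last event, so `j` cannot have left round `r`, and its view is an
  -- early one.
  have hround : (localAt t F prop A c (l + 1) j).round ≤ r := by
    have h1 : (localAt t F prop A c l j).round ≤ r := by
      by_contra hcon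
      exact (run_globalInv l).coin_prev j hj r hr (not_le.1 hcon) hl
    rcases (localAt_step l j).round_cases with ⟨h2, -⟩ | ⟨-, h2⟩ | ⟨-, b, hb, h2⟩
    · exact h2 ▸ h1
    · exact h2.le.trans hr
    · rw [h2, (coinReturn_fields _ _ _).2.1]
      refine Nat.lt_of_le_of_ne h1 fun h3 => ?_
      rw [h3, hl] at hb
      cases hb
  obtain ⟨hjr, hjpc⟩ := hjp.resolve_left (not_lt.2 hround)
  obtain ⟨k₁, hk₁, hk₁'⟩ := exists_round_of_aux_sent hjw
  obtain ⟨k₂, -, h4, h5, -, h6, h7⟩ := exists_endRound hr hk₁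
  have hview := view_eq_of_waitCoin hj h5 hjpc (h4.trans hjr)
  have hsupp : (localAt t F prop A c k₁ j).support = true := by
    rw [h7, hview]
    refine nextSupport_of_mem ?_
    by_contra hcon
    -- A view without `c r` would be the early singleton `{¬c r}`. So `j` supports the coin, and its
    -- AUX value in round `r + 1` is `c r`.
    refine not_earlyView_of_earlyValue h (!c r) ⟨l, j, hj, hl, hjpc, hjr.symm, ?_⟩
    exact mem_of_ne_not_mem (view_nonempty ht hF hj hjpc) (by simpa using hcon)
  have := (localAt_inv hj k₁).aux_support w (by rw [hk₁]; exact hk₁') hsupp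
  rw [h6] at this
  exact this ▸ hw

/-- What the stage at the start of round `m + 1` says about the execution. -/
def Stage.Holds (t : ℕ) (F : Finset (Fin n)) (prop : Fin n → Bool) (A : Adversary n)
    (c : ℕ → Bool) (m : ℕ) : Stage → Prop
  | .undetermined => True
  | .aligned v => ∀ i ∉ F, ∀ k, (localAt t F prop A c k i).pc = .waitCoin →
      (localAt t F prop A c k i).round = m + 1 → v ∈ (localAt t F prop A c k i).view
  | .locked v => Locked t F prop A c (m + 1) v
  | .decided => ∀ i ∉ F, ∀ k, (localAt t F prop A c k i).round = m + 1 →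
      (localAt t F prop A c k i).decision ≠ none

lemma stage_holds (ht : 3 * t < n) (hF : F.card ≤ t) (m : ℕ) :
    (stage t F prop A c m).Holds t F prop A c m := by
  induction m with
  | zero => trivial
  | succ m ih =>
    rw [stage]
    revert ih
    generalize stage t F prop A c m = q
    intro ih
    cases q with
    | undetermined =>
      simp only [Stage.next]
      split
      · rename_i v hv
        split_ifs with hcv
        · obtain ⟨k, i, hi, -, h2, h3, h4⟩ := earlyView_of_earlyValue hv
          subst hcv
          exact locked_of_view ht hF hi h2 h3 h4
        · trivial
      · rename_i hv
        exact fun i hi k h1 h2 => mem_view_of_earlyValue_none ht hF (by omega) hv hi h1 h2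
    | aligned v =>
      simp only [Stage.next]
      split_ifs with hcv
      · subst hcv
        exact Locked.of_mem hF (by omega) ih
      · trivial
    | locked v =>
      simp only [Stage.next]
      split_ifs with hcv
      · intro i hi k hk
        obtain ⟨k', hlt, h1, h2, h3, -⟩ := exists_endRound (by omega) hk
        -- All views are the locked value, which the coin now shows, so each process decides here
        -- unless it has decided before.
        have hv := ih.view_eq ht hF (by omega) hi h2 h1
        have hd : (localAt t F prop A c (k' + 1) i).decision ≠ none := by
          rw [h3, (coinReturn_fields _ _ _).2.2.2.2]
          split_ifs with h4
          · simp
          · exact fun h5 => h4 ⟨by rw [hv, hcv], h5⟩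
        obtain ⟨x, hx⟩ := Option.ne_none_iff_exists'.1 hd
        rw [decision_mono hlt hx]
        simp
      · exact ih.succ ht hF (by omega)
    | decided =>
      intro i hi k hk
      obtain ⟨k', hlt, h1, -⟩ := exists_endRound (by omega) hk
      obtain ⟨x, hx⟩ := Option.ne_none_iff_exists'.1 (ih i hi k' h1)
      rw [decision_mono hlt.le hx]
      simp

/-- The stage speaks only of processes that get to round `m + 1`; liveness brings all of them there.
-/
lemma exists_decides_of_stage (ht : 3 * t < n) (hF : F.card ≤ t) (hA : Admissible t F prop A c)
    {m : ℕ} (hm : stage t F prop A c m = .decided) {i : Fin n} (hi : i ∉ F) :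
    ∃ r ≤ m, ∃ v, Decides t F prop A c i r v := by
  obtain ⟨k, hk⟩ := (eventually_le_round ht hF hA (m + 1) i hi).exists
  obtain ⟨k', hk'⟩ := exists_round_eq (by omega) hk
  have h := stage_holds (prop := prop) (A := A) (c := c) ht hF m
  rw [hm] at h
  obtain ⟨⟨r, v⟩, hx⟩ := Option.ne_none_iff_exists'.1 (h i hi k' hk')
  have := (localAt_inv hi k').decision_lt r v hx
  exact ⟨r, by omega, v, k', hx⟩

/-- The number of rounds whose stage is not `decided`. -/
noncomputable def undecidedRounds (t : ℕ) (F : Finset (Fin n)) (prop : Fin n → Bool)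
    (A : Adversary n) (c : ℕ → Bool) : ℝ≥0∞ :=
  ∑' m, if stage t F prop A c m = .decided then 0 else 1

lemma exists_stage_decided (h : undecidedRounds t F prop A c ≠ ∞) :
    ∃ m, stage t F prop A c m = .decided := by
  by_contra! hcon
  apply h
  simp only [undecidedRounds, hcon, if_false]
  exact ENNReal.tsum_const_eq_top_of_ne_zero one_ne_zero

/-- If `m` is the first decided stage, everybody decides by round `m`, and the `m` stages before it
each contribute 1 to the sum. -/
lemma lastDecisionRound_le (ht : 3 * t < n) (hF : F.card ≤ t) (hA : Admissible t F prop A c) :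
    lastDecisionRound t F prop A c ≤ undecidedRounds t F prop A c := by
  classical
  by_cases h : undecidedRounds t F prop A c = ∞
  · rw [h]; exact le_top
  have hex := exists_stage_decided h
  have h1 : lastDecisionRound t F prop A c ≤ (Nat.find hex : ℝ≥0∞) := by
    refine iSup₂_le fun i hi => ?_
    obtain ⟨r, hr, v, hd⟩ := exists_decides_of_stage ht hF hA (Nat.find_spec hex) hi
    exact (iInf_le_of_le r (iInf₂_le v hd)).trans (by exact_mod_cast hr)
  refine h1.trans ?_
  calc (Nat.find hex : ℝ≥0∞)
      = ∑ m ∈ Finset.range (Nat.find hex),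
          if stage t F prop A c m = .decided then (0 : ℝ≥0∞) else 1 := by
        rw [Finset.sum_congr rfl fun m hm =>
          if_neg (Nat.find_min hex (Finset.mem_range.1 hm))]
        simp
    _ ≤ _ := ENNReal.sum_le_tsum _

/-- An event can look only at the coin of the current round of one of the `n` processes, so `k`
events depend on finitely many coins. This gives measurability for an arbitrary strategy `A`. -/
lemma isLocallyConstant_run (k : ℕ) : IsLocallyConstant fun c => run t F prop A c k := by
  induction k with
  | zero => exact IsLocallyConstant.const _
  | succ k ih =>
    rw [IsLocallyConstant.iff_eventually_eq] at ih ⊢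
    intro c
    have h : ∀ᶠ c' in nhds c, ∀ i, c' ((run t F prop A c k).2.loc i).round =
        c ((run t F prop A c k).2.loc i).round := by
      rw [eventually_all]
      intro i
      have := (continuous_apply (A := fun _ : ℕ => Bool)
        ((run t F prop A c k).2.loc i).round).continuousAt (x := c)
      exact this.eventually_mem ((isOpen_discrete {c _}).mem_nhds rfl)
    filter_upwards [ih c, h] with c' h1 h2
    simp only [run]
    rw [h1]
    congr 1
    exact Config.step_congr fun i _ _ _ _ _ _ => h2 i

lemma measurableSet_decides (i : Fin n) (r : ℕ) (v : Bool) :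
    MeasurableSet {c | Decides t F prop A c i r v} := by
  have : {c | Decides t F prop A c i r v} =
      ⋃ k, (fun c => run t F prop A c k) ⁻¹' {h | (h.2.loc i).decision = some (r, v)} := by
    ext c; simp [Decides, localAt]
  rw [this]
  exact MeasurableSet.iUnion fun k => (isLocallyConstant_run k _).measurableSet

lemma measurable_lastDecisionRound : Measurable fun c => lastDecisionRound t F prop A c := by
  classical
  refine Measurable.iSup fun i => Measurable.iSup fun _ => Measurable.iInf fun r =>
    Measurable.iInf fun v => ?_
  simp only [iInf_eq_if]
  exact Measurable.ite (measurableSet_decides i r v) measurable_const measurable_const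

end Coins

/-! ### The expected number of rounds. -/

section Expectation

/-- An upper bound for the expected number of further rounds without a common decision. -/
noncomputable def Stage.potential : Stage → ℝ≥0∞
  -- The values solve `L = 1 + L/2`, `a = 1 + L/2 + U/2`, `U = 1 + a` for locked, aligned and
  -- undetermined. With an early value, the undetermined stage would need only `1 + L/2 + U/2 = 5`.
  | .undetermined => 6
  | .aligned _ => 5
  | .locked _ => 2
  | .decided => 0

lemma Stage.potential_next_le (g : Option Bool) (q : Stage) :
    (if q = .decided then 0 else 1) +
      ((q.next g true).potential * 2⁻¹ + (q.next g false).potential * 2⁻¹) ≤ q.potential := by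
  have h5 : (5 : ℝ≥0∞) * 2⁻¹ + 5 * 2⁻¹ = 5 := by
    rw [← mul_add, ENNReal.inv_two_add_inv_two, mul_one]
  have h2 : (2 : ℝ≥0∞) * 2⁻¹ = 1 := ENNReal.mul_inv_cancel (by simp) (by simp)
  have h6 : (6 : ℝ≥0∞) * 2⁻¹ = 3 := by
    rw [show (6 : ℝ≥0∞) = 3 * 2 by norm_num, mul_assoc, h2, mul_one]
  cases q with
  | undetermined =>
    rcases g with _ | v
    · simp only [Stage.next, Stage.potential, h5, reduceCtorEq, if_false]; norm_num
    · cases v <;> simp [Stage.next, Stage.potential, h2, h6] <;> norm_num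
  | aligned v => cases v <;> simp [Stage.next, Stage.potential, h2, h6] <;> norm_num
  | locked v => cases v <;> simp [Stage.next, Stage.potential, h2] <;> norm_num
  | decided => simp [Stage.next, Stage.potential]

variable {Ω : Type*} [MeasurableSpace Ω] {μ : Measure Ω} {coin : ℕ → Ω → Bool}

/-- A function of finitely many coins, as a function of a finite tuple. -/
lemma exists_eq_comp_prefix {N : ℕ} {f : (ℕ → Bool) → ℝ≥0∞}
    (hf : ∀ c c' : ℕ → Bool, (∀ r < N, c r = c' r) → f c = f c') :
    ∃ g : (Finset.range N → Bool) → ℝ≥0∞, Measurable g ∧ ∀ c, f c = g fun r => c r := by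
  refine ⟨fun p => f fun r => if h : r ∈ Finset.range N then p ⟨r, h⟩ else false,
    measurable_of_finite _, fun c => hf _ _ fun r hr => ?_⟩
  simp [hr]

lemma IsStrongCoin.measurable_prefix (h : IsStrongCoin μ coin) {N : ℕ} {f : (ℕ → Bool) → ℝ≥0∞}
    (hf : ∀ c c' : ℕ → Bool, (∀ r < N, c r = c' r) → f c = f c') :
    Measurable fun ω => f fun r => coin r ω := by
  obtain ⟨g, hg, hfg⟩ := exists_eq_comp_prefix hf
  simp only [hfg]
  exact hg.comp (measurable_pi_lambda _ fun r => h.measurable r)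

lemma IsStrongCoin.lintegral_prefix_mul (h : IsStrongCoin μ coin) {N : ℕ}
    {f : (ℕ → Bool) → ℝ≥0∞} (hf : ∀ c c' : ℕ → Bool, (∀ r < N, c r = c' r) → f c = f c')
    (b : Bool) :
    ∫⁻ ω, (f fun r => coin r ω) * (if coin N ω = b then 1 else 0) ∂μ =
      (∫⁻ ω, f fun r => coin r ω ∂μ) * 2⁻¹ := by
  obtain ⟨g, hg, hfg⟩ := exists_eq_comp_prefix hf
  have hind := h.indep.indepFun_finset (Finset.range N) {N} (by simp) h.measurable
  have hX : Measurable fun ω => g fun r : Finset.range N => coin r ω :=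
    hg.comp (measurable_pi_lambda _ fun r => h.measurable r)
  have hbm : MeasurableSet {ω | coin N ω = b} := h.measurable N (measurableSet_singleton b)
  have hY : Measurable fun ω => if coin N ω = b then (1 : ℝ≥0∞) else 0 :=
    Measurable.ite hbm measurable_const measurable_const
  have hind' := hind.comp hg (ψ := fun y : ({N} : Finset ℕ) → Bool =>
    if y ⟨N, by simp⟩ = b then (1 : ℝ≥0∞) else 0) (measurable_of_finite _)
  have := lintegral_mul_eq_lintegral_mul_lintegral_of_indepFun hX hY hind'
  simp only [hfg]
  simp only [Pi.mul_apply] at this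
  rw [this]
  congr 1
  have h1 : (fun ω => if coin N ω = b then (1 : ℝ≥0∞) else 0) =
      {ω | coin N ω = b}.indicator 1 := by
    ext ω; simp [Set.indicator_apply]
  rw [h1, lintegral_indicator_one hbm, h.fair N b, one_div]

variable {n t : ℕ} {F : Finset (Fin n)} {prop : Fin n → Bool} {A : Adversary n}

/-- The stage and the early value depend only on coins before round `m + 1`, so the coin of that
round is fair and independent of them. Averaging over it reduces the claim to
`Stage.potential_next_le`. -/
lemma lintegral_potential_succ_le (h : IsStrongCoin μ coin) (m : ℕ) :
    ∫⁻ ω, (if stage t F prop A (fun r => coin r ω) m = .decided then 0 else 1) ∂μ +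
      ∫⁻ ω, (stage t F prop A (fun r => coin r ω) (m + 1)).potential ∂μ ≤
      ∫⁻ ω, (stage t F prop A (fun r => coin r ω) m).potential ∂μ := by
  let q : Bool → (ℕ → Bool) → ℝ≥0∞ := fun b c =>
    ((stage t F prop A c m).next (earlyValue t F prop A c (m + 1)) b).potential
  let d : (ℕ → Bool) → ℝ≥0∞ := fun c => if stage t F prop A c m = .decided then 0 else 1
  have hq : ∀ b, ∀ c c' : ℕ → Bool, (∀ r < m + 1, c r = c' r) → q b c = q b c' := by
    intro b c c' hc
    simp only [q]
    rw [stage_congr hc, earlyValue_congr (by omega) hc]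
  have hd : ∀ c c' : ℕ → Bool, (∀ r < m + 1, c r = c' r) → d c = d c' := by
    intro c c' hc
    simp only [d]
    rw [stage_congr hc]
  have hqm := fun b => h.measurable_prefix (hq b)
  have hdm := h.measurable_prefix hd
  have hif : ∀ b, Measurable fun ω => if coin (m + 1) ω = b then (1 : ℝ≥0∞) else 0 := fun b =>
    Measurable.ite (h.measurable (m + 1) (measurableSet_singleton b)) measurable_const
      measurable_const
  have h1 : ∀ ω, (stage t F prop A (fun r => coin r ω) (m + 1)).potential =
      q true (fun r => coin r ω) * (if coin (m + 1) ω = true then 1 else 0) +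
      q false (fun r => coin r ω) * (if coin (m + 1) ω = false then 1 else 0) := by
    intro ω
    rw [stage]
    cases hb : coin (m + 1) ω <;> simp [q]
  have hmul : Measurable fun ω =>
      q true (fun r => coin r ω) * if coin (m + 1) ω = true then 1 else 0 :=
    (hqm true).mul (hif true)
  simp only [h1]
  rw [lintegral_add_left hmul, h.lintegral_prefix_mul (hq true),
    h.lintegral_prefix_mul (hq false), ← lintegral_mul_const _ (hqm true),
    ← lintegral_mul_const _ (hqm false), ← lintegral_add_left ((hqm true).mul_const _),
    ← lintegral_add_left hdm]
  exact lintegral_mono fun ω => Stage.potential_next_le _ _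

lemma lintegral_undecidedRounds_le [IsProbabilityMeasure μ] (h : IsStrongCoin μ coin) :
    ∫⁻ ω, undecidedRounds t F prop A (fun r => coin r ω) ∂μ ≤ 6 := by
  have hd : ∀ m, ∀ c c' : ℕ → Bool, (∀ r < m + 1, c r = c' r) →
      (if stage t F prop A c m = .decided then (0 : ℝ≥0∞) else 1) =
        if stage t F prop A c' m = .decided then 0 else 1 := by
    intro m c c' hc
    rw [stage_congr hc]
  simp only [undecidedRounds]
  rw [lintegral_tsum fun m => (h.measurable_prefix (hd m)).aemeasurable]
  refine ENNReal.tsum_le_of_sum_range_le fun N => ?_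
  -- The one-round inequalities telescope from the initial potential 6.
  have hN : ∑ m ∈ Finset.range N,
        ∫⁻ ω, (if stage t F prop A (fun r => coin r ω) m = .decided then 0 else 1) ∂μ +
      ∫⁻ ω, (stage t F prop A (fun r => coin r ω) N).potential ∂μ ≤ 6 := by
    induction N with
    | zero => simp [stage, Stage.potential]
    | succ N ih =>
      rw [Finset.sum_range_succ, add_assoc]
      exact (by gcongr; exact lintegral_potential_succ_le h N : _ ≤ _).trans ih
  exact le_self_add.trans hN

end Expectation

end BBC

theorem mainTheorem2 {n t : ℕ} (ht : 3 * t < n)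
    (F : Finset (Fin n)) (hF : F.card ≤ t)
    (prop : Fin n → Bool) (A : BBC.Adversary n)
    {Ω : Type*} [MeasurableSpace Ω] (μ : Measure Ω) [IsProbabilityMeasure μ]
    (coin : ℕ → Ω → Bool) (hcoin : BBC.IsStrongCoin μ coin) :
    -- Agreement
    (∀ c : ℕ → Bool, ∀ i ∉ F, ∀ j ∉ F, ∀ r r' v v',
      BBC.Decides t F prop A c i r v → BBC.Decides t F prop A c j r' v' → v = v') ∧
    -- Validity
    (∀ c : ℕ → Bool, ∀ u : Bool, (∀ i ∉ F, prop i = u) →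
      ∀ i ∉ F, ∀ r v, BBC.Decides t F prop A c i r v → v = u) ∧
    -- Only the value of the coin of a round can be decided in that round
    (∀ c : ℕ → Bool, ∀ i ∉ F, ∀ r v, BBC.Decides t F prop A c i r v → v = c r) ∧
    -- Broadcasts: 2 to 3 in the first round, 1 to 2 in each later round
    (∀ c : ℕ → Bool, ∀ i ∉ F, ∀ k,
      BBC.broadcasts t F prop A c k i 1 ≤ 3 ∧
      (1 < (BBC.localAt t F prop A c k i).round → 2 ≤ BBC.broadcasts t F prop A c k i 1) ∧
      ∀ r, 2 ≤ r →
        BBC.broadcasts t F prop A c k i r ≤ 2 ∧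
        (r < (BBC.localAt t F prop A c k i).round → 1 ≤ BBC.broadcasts t F prop A c k i r)) ∧
    -- Termination with probability one, in an expected constant number of rounds
    ((∀ᵐ ω ∂μ, BBC.Admissible t F prop A (fun r => coin r ω)) →
      (∀ᵐ ω ∂μ, ∀ i ∉ F, ∃ r v, BBC.Decides t F prop A (fun r => coin r ω) i r v) ∧
      Measurable (fun ω => BBC.lastDecisionRound t F prop A (fun r => coin r ω)) ∧
      ∫⁻ ω, BBC.lastDecisionRound t F prop A (fun r => coin r ω) ∂μ ≤ 6) := by
  have hle := BBC.lintegral_undecidedRounds_le (t := t) (F := F) (prop := prop) (A := A) hcoin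
  refine ⟨fun c i hi j hj r r' v v' => BBC.agreement ht hF hi hj,
    fun c u hu i hi r v => BBC.validity ht hF hu hi,
    fun c i _ r v => BBC.decides_eq_coin,
    fun c i hi k => ⟨(BBC.broadcasts_first hi k).1, (BBC.broadcasts_first hi k).2,
      fun r hr => BBC.broadcasts_later hi k hr⟩,
    fun hA => ⟨?_, ?_, ?_⟩⟩
  · have hm : Measurable fun ω => BBC.undecidedRounds t F prop A fun r => coin r ω := by
      refine Measurable.tsum fun m => hcoin.measurable_prefix (N := m + 1)
        (f := fun c => if BBC.stage t F prop A c m = .decided then 0 else 1) fun c c' hc => ?_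
      rw [BBC.stage_congr hc]
    -- A finite expectation makes the number of undecided rounds finite almost surely, so the
    -- decided stage is reached.
    filter_upwards [hA, ae_lt_top hm (hle.trans_lt (by simp)).ne] with ω h1 h2 i hi
    obtain ⟨m, hm⟩ := BBC.exists_stage_decided h2.ne
    obtain ⟨r, -, v, h⟩ := BBC.exists_decides_of_stage ht hF h1 hm hi
    exact ⟨r, v, h⟩
  · exact BBC.measurable_lastDecisionRound.comp (measurable_pi_lambda _ hcoin.measurable)
  · refine (lintegral_mono_ae ?_).trans hle
    filter_upwards [hA] with ω h
    exact BBC.lastDecisionRound_le ht hF h
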